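/- For every integer $n\ge 1$ let $\beta=\beta_n>0$ and let $p_1=p_1(n)$, $p_2=p_2(n)$ be real numbers with $p_1,p_2\ge n$; put $\beta'=\beta/2$. Let $c_1,\dots,c_n,s_1,\dots,s_{n-1}$ (depending on $n$) be independent random variables with $$c_k\sim \mathrm{Beta}\big(\beta'(p_1-k+1),\,\beta'(p_2-k+1)\big)\ (1\le k\le n),\qquad s_k\sim \mathrm{Beta}\big(\beta'(n-k),\,\beta'(p_1+p_2-n-k+1)\big)\ (1\le k\le n-1),$$ set $c_0=s_0=0$, and $$a_k=s_{k-1}(1-c_{k-1})+c_k(1-s_{k-1})\ (1\le k\le n),\qquad b_k=\sqrt{c_k(1-c_k)s_k(1-s_{k-1})}\ (1\le k\le n-1).$$ Let $\mathcal J_n$ be the symmetric tridiagonal $n\times n$ matrix with diagonal $a_1,\dots,a_n$ and off-diagonal $b_1,\dots,b_{n-1}$, let $$\widetilde{\mathcal J}_n=\frac{(p_1+p_2)\mathcal J_n-p_1 I_n}{\sqrt{n p_1}},$$ and let $\mu_n$ be the spectral measure of $\widetilde{\mathcal J}_n$, i.e. the unique probability measure on $\mathbb R$ with $\int x^k\,d\mu_n=(\widetilde{\mathcal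 J}_n^{\,k})(1,1)$ for all integers $k\ge 0$. Assume $$(\mathbf H):\qquad \lim_{n\to\infty}\frac{n}{p_1}=\gamma\in[0,1],\qquad \lim_{n\to\infty}\frac{p_1}{p_2}=\sigma\in[0,\gamma^{-1}),\qquad \lim_{n\to\infty}\beta n=+\infty,$$ where $\gamma^{-1}=+\infty$ if $\gamma=0$. Then for each polynomial $p$ with real coefficients there is a constant $\sigma_p^2\ge 0$, depending only on $p$, $\gamma$ and $\sigma$, such that, with $\langle\mu_n,p\rangle=\int p\,d\mu_n$ (an integrable random variable for every $n$), $$\sqrt{\beta' n}\,\big(\langle\mu_n,p\rangle-\mathbb E\langle\mu_n,p\rangle\big)\longrightarrow \mathcal N(0,\sigma_p^2)$$ weakly as $n\to\infty$ (where $\mathcal N(0,0)$ is the unit mass at $0$). -/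

import Mathlib

open MeasureTheory ProbabilityTheory Filter Topology Polynomial
open scoped NNReal ENNReal

noncomputable section

/-- A probability measure `μ` on `ℝ` with finite moments is a spectral measure of the (symmetric)
matrix `J` if `⟨μ, x ^ k⟩ = (J ^ k)(1, 1)` for every `k`. -/
structure IsSpectralMeasure {n : ℕ} [NeZero n] (J : Matrix (Fin n) (Fin n) ℝ)
    (μ : Measure ℝ) : Prop where
  isProbabilityMeasure : IsProbabilityMeasure μ
  integrable : ∀ k : ℕ, Integrable (fun x : ℝ => x ^ k) μ
  moment : ∀ k : ℕ, ∫ x, x ^ k ∂μ = (J ^ k) 0 0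

theorem IsSpectralMeasure.integrable_eval {n : ℕ} [NeZero n] {J : Matrix (Fin n) (Fin n) ℝ}
    {μ : Measure ℝ} (h : IsSpectralMeasure J μ) (p : ℝ[X]) :
    Integrable (fun x => p.eval x) μ := by
  simp only [Polynomial.eval_eq_sum_range]
  exact integrable_finsetSum _ fun k _ => (h.integrable k).const_mul _

theorem IsSpectralMeasure.integral_eval {n : ℕ} [NeZero n] {J : Matrix (Fin n) (Fin n) ℝ}
    {μ : Measure ℝ} (h : IsSpectralMeasure J μ) (p : ℝ[X]) :
    ∫ x, p.eval x ∂μ = (aeval J p) 0 0 := by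
  simp only [Polynomial.eval_eq_sum_range, Polynomial.aeval_eq_sum_range]
  rw [integral_finsetSum _ fun k _ => (h.integrable k).const_mul _, Matrix.sum_apply]
  refine Finset.sum_congr rfl fun k _ => ?_
  rw [integral_const_mul, h.moment, Matrix.smul_apply, smul_eq_mul]

theorem IsSpectralMeasure.eq {n : ℕ} [NeZero n] {J : Matrix (Fin n) (Fin n) ℝ}
    {μ ν : Measure ℝ} (hμ : IsSpectralMeasure J μ) (hν : IsSpectralMeasure J ν) : μ = ν := by
  classical
  have key : ∀ ρ : Measure ℝ, IsSpectralMeasure J ρ → ∀ s : Set ℝ, MeasurableSet s →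
      ρ.real s = (aeval J (Lagrange.interpolate J.charpoly.roots.toFinset id
        (fun x => s.indicator (fun _ => (1 : ℝ)) x))) 0 0 := by
    intro ρ h s hs
    have := h.isProbabilityMeasure
    rw [← h.integral_eval, ← integral_indicator_one hs]
    refine integral_congr_ae ?_
    have h0 : ∫ x, (J.charpoly ^ 2).eval x ∂ρ = 0 := by
      rw [h.integral_eval, map_pow, Matrix.aeval_self_charpoly]; simp
    have h1 : (fun x => (J.charpoly ^ 2).eval x) =ᵐ[ρ] 0 := by
      refine (integral_eq_zero_iff_of_nonneg (fun x => ?_) (h.integrable_eval _)).1 h0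
      simp only [Pi.zero_apply, eval_pow]; positivity
    filter_upwards [h1] with x hx
    have hx' : x ∈ J.charpoly.roots.toFinset := by
      simp only [Pi.zero_apply, eval_pow] at hx
      rw [Multiset.mem_toFinset, mem_roots (Matrix.charpoly_monic J).ne_zero]
      exact pow_eq_zero_iff (two_ne_zero) |>.1 hx
    exact (Lagrange.eval_interpolate_at_node (v := id) _ (Set.injOn_id _) hx').symm
  have := hμ.isProbabilityMeasure
  have := hν.isProbabilityMeasure
  ext s hs
  rw [← measureReal_eq_measureReal_iff, key μ hμ s hs, key ν hν s hs]

theorem exists_isSpectralMeasure {n : ℕ} [NeZero n] {J : Matrix (Fin n) (Fin n) ℝ}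
    (hJ : J.IsHermitian) : ∃ μ : Measure ℝ, IsSpectralMeasure J μ := by
  classical
  set U : Matrix (Fin n) (Fin n) ℝ := (hJ.eigenvectorUnitary : Matrix (Fin n) (Fin n) ℝ) with hU
  have hUU : star U * U = 1 := Unitary.coe_star_mul_self hJ.eigenvectorUnitary
  have hUU' : U * star U = 1 := Unitary.coe_mul_star_self hJ.eigenvectorUnitary
  have hspec : J = U * Matrix.diagonal hJ.eigenvalues * star U := by
    have := hJ.spectral_theorem
    simpa [Unitary.conjStarAlgAut_apply] using this
  have hpow : ∀ k : ℕ, J ^ k = U * Matrix.diagonal (hJ.eigenvalues ^ k) * star U := by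
    intro k
    induction k with
    | zero => simp [hUU']
    | succ k ih =>
      calc J ^ (k + 1) = (U * Matrix.diagonal (hJ.eigenvalues ^ k) * star U) *
            (U * Matrix.diagonal hJ.eigenvalues * star U) := by rw [pow_succ, ih, ← hspec]
        _ = U * Matrix.diagonal (hJ.eigenvalues ^ k) * (star U * U) *
            Matrix.diagonal hJ.eigenvalues * star U := by simp only [Matrix.mul_assoc]
        _ = _ := by
          rw [hUU, Matrix.mul_one, Matrix.mul_assoc U, Matrix.diagonal_mul_diagonal]
          rfl
  have hent : ∀ k : ℕ, (J ^ k) 0 0 = ∑ i, U 0 i ^ 2 * hJ.eigenvalues i ^ k := by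
    intro k
    rw [hpow k, Matrix.mul_apply]
    refine Finset.sum_congr rfl fun i _ => ?_
    simp [Matrix.mul_diagonal, Matrix.star_apply]
    ring
  have hint : ∀ f : ℝ → ℝ, ∀ i ∈ Finset.univ, Integrable f
      (ENNReal.ofReal (U 0 i ^ 2) • Measure.dirac (hJ.eigenvalues i)) := fun f i _ =>
    (integrable_dirac (by finiteness)).smul_measure ENNReal.ofReal_ne_top
  refine ⟨∑ i, ENNReal.ofReal (U 0 i ^ 2) • Measure.dirac (hJ.eigenvalues i), ⟨?_⟩, ?_, ?_⟩
  · have := hent 0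
    simp only [pow_zero, Matrix.one_apply_eq, mul_one] at this
    simp only [Measure.finsetSum_apply, Measure.smul_apply, measure_univ, smul_eq_mul, mul_one]
    rw [← ENNReal.ofReal_sum_of_nonneg (fun i _ => sq_nonneg _), ← this, ENNReal.ofReal_one]
  · exact fun k => integrable_finsetSum_measure.2 (hint _)
  · intro k
    rw [integral_finsetSum_measure (hint _), hent k]
    refine Finset.sum_congr rfl fun i _ => ?_
    rw [integral_smul_measure, integral_dirac, ENNReal.toReal_ofReal (sq_nonneg _), smul_eq_mul]

/-- The spectral measure of a symmetric matrix `J`: the unique probability measure on `ℝ` with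
`⟨μ, x ^ k⟩ = (J ^ k)(1, 1)` for all `k`. -/
def spectralMeasure {n : ℕ} [NeZero n] (J : Matrix (Fin n) (Fin n) ℝ) (hJ : J.IsHermitian) :
    Measure ℝ :=
  (exists_isSpectralMeasure hJ).choose

theorem isSpectralMeasure_spectralMeasure {n : ℕ} [NeZero n] {J : Matrix (Fin n) (Fin n) ℝ}
    (hJ : J.IsHermitian) : IsSpectralMeasure J (spectralMeasure J hJ) :=
  (exists_isSpectralMeasure hJ).choose_spec

/-- The `n × n` symmetric tridiagonal matrix with diagonal `a 1, …, a n` and off-diagonal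
`b 1, …, b (n - 1)`; the row with zero-based index `i : Fin n` is row number `i + 1`. -/
def tridiagonal (n : ℕ) (a b : ℕ → ℝ) : Matrix (Fin n) (Fin n) ℝ :=
  Matrix.of fun i j =>
    if (i : ℕ) = j then a (i + 1)
    else if (i : ℕ) + 1 = j then b (i + 1)
    else if (j : ℕ) + 1 = i then b (j + 1)
    else 0

/-- Diagonal coefficients `a k = s (k-1) (1 - c (k-1)) + c k (1 - s (k-1))`, used for `1 ≤ k`. -/
def coeffA (c s : ℕ → ℝ) (k : ℕ) : ℝ :=
  s (k - 1) * (1 - c (k - 1)) + c k * (1 - s (k - 1))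

/-- Off-diagonal coefficients `b k = √(c k (1 - c k) s k (1 - s (k-1)))`, used for `1 ≤ k`. -/
def coeffB (c s : ℕ → ℝ) (k : ℕ) : ℝ :=
  √(c k * (1 - c k) * s k * (1 - s (k - 1)))

/-- The tridiagonal matrix of the `β`-Jacobi ensemble built from `c 1, …, c n` and
`s 1, …, s (n - 1)`, with `c 0 = s 0 = 0` imposed by the hypotheses on `c` and `s`. -/
def jacobiMatrix (n : ℕ) (c s : ℕ → ℝ) : Matrix (Fin n) (Fin n) ℝ :=
  tridiagonal n (coeffA c s) (coeffB c s)

/-- The rescaled matrix `((p₁ + p₂) J - p₁ I) / √(n p₁)`. -/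
def rescaledJacobiMatrix (n : ℕ) (p₁ p₂ : ℝ) (c s : ℕ → ℝ) : Matrix (Fin n) (Fin n) ℝ :=
  (√(n * p₁))⁻¹ • ((p₁ + p₂) • jacobiMatrix n c s - p₁ • (1 : Matrix (Fin n) (Fin n) ℝ))

theorem isHermitian_rescaledJacobiMatrix (n : ℕ) (p₁ p₂ : ℝ) (c s : ℕ → ℝ) :
    (rescaledJacobiMatrix n p₁ p₂ c s).IsHermitian := by
  have h : (jacobiMatrix n c s).IsHermitian := by
    ext i j
    simp only [Matrix.conjTranspose_apply, star_trivial, jacobiMatrix, tridiagonal, Matrix.of_apply]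
    split_ifs <;> first | rfl | omega | simp_all
  have hs : ∀ (r : ℝ) (A : Matrix (Fin n) (Fin n) ℝ), A.IsHermitian → (r • A).IsHermitian := by
    intro r A hA
    rw [Matrix.IsHermitian, Matrix.conjTranspose_smul, hA.eq, star_trivial]
  exact hs _ _ ((hs _ _ h).sub (hs _ _ Matrix.isHermitian_one))

/-- The variables `c 1, …, c n, s 1, …, s (n - 1)` are independent with
`c k ∼ Beta(β' (p₁ - k + 1), β' (p₂ - k + 1))` and
`s k ∼ Beta(β' (n - k), β' (p₁ + p₂ - n - k + 1))`, where `β' = β / 2`; and `c 0 = s 0 = 0`. -/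
structure IsJacobiCoefficients {Ω : Type*} [MeasurableSpace Ω] (P : Measure Ω)
    (n : ℕ) (β p₁ p₂ : ℝ) (c s : ℕ → Ω → ℝ) : Prop where
  c_zero : ∀ ω, c 0 ω = 0
  s_zero : ∀ ω, s 0 ω = 0
  law_c : ∀ k ∈ Finset.Icc 1 n,
    HasLaw (c k) (betaMeasure (β / 2 * (p₁ - k + 1)) (β / 2 * (p₂ - k + 1))) P
  law_s : ∀ k ∈ Finset.Icc 1 (n - 1),
    HasLaw (s k) (betaMeasure (β / 2 * (n - k)) (β / 2 * (p₁ + p₂ - n - k + 1))) P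
  indep : iIndepFun (Sum.elim (fun k : Finset.Icc 1 n => c k)
    (fun k : Finset.Icc 1 (n - 1) => s k)) P

/-- The assumption on the parameters: `β n > 0`, `p₁ n, p₂ n ≥ n`, `n / p₁ n → γ ∈ [0, 1]`,
`p₁ n / p₂ n → σ ∈ [0, γ⁻¹)` (with `γ⁻¹ = +∞` for `γ = 0`) and `β n * n → +∞`. -/
structure AssumptionH (β p₁ p₂ : ℕ+ → ℝ) (γ σ : ℝ) : Prop where
  beta_pos : ∀ n, 0 < β n
  le_p₁ : ∀ n : ℕ+, (n : ℝ) ≤ p₁ n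
  le_p₂ : ∀ n : ℕ+, (n : ℝ) ≤ p₂ n
  gamma_mem : γ ∈ Set.Icc (0 : ℝ) 1
  sigma_nonneg : 0 ≤ σ
  sigma_mul_gamma_lt : σ * γ < 1
  tendsto_gamma : Tendsto (fun n : ℕ+ => (n : ℝ) / p₁ n) atTop (𝓝 γ)
  tendsto_sigma : Tendsto (fun n : ℕ+ => p₁ n / p₂ n) atTop (𝓝 σ)
  tendsto_beta : Tendsto (fun n : ℕ+ => β n * (n : ℝ)) atTop atTop

/-- The random variable `ω ↦ ⟨μ, p⟩ = ∫ p dμ`, where `μ` is the (random) spectral measure of the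
rescaled matrix with random coefficients `c k ω`, `s k ω`. -/
def spectralPairing {Ω : Type*} (n : ℕ) [NeZero n] (p₁ p₂ : ℝ) (c s : ℕ → Ω → ℝ) (p : ℝ[X])
    (ω : Ω) : ℝ :=
  ∫ x, p.eval x ∂(spectralMeasure
    (rescaledJacobiMatrix n p₁ p₂ (fun k => c k ω) (fun k => s k ω))
    (isHermitian_rescaledJacobiMatrix n p₁ p₂ (fun k => c k ω) (fun k => s k ω)))

end

/-! The proof is a delta method. Put t = √(β'n). For fixed p and n ≥ deg p, ⟨μ_n, p⟩ is one fixed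
polynomial in finitely many diagonal entries and squared off-diagonal entries of the rescaled
matrix. These entries are in turn polynomials, with convergent coefficients, in D_k =
√(p₁/n)((p₁+p₂)c_k/p₁ - 1) and S_k = (p₁+p₂)s_k/n. The variables D_k and S_k converge to constants
and fluctuate on the scale 1/t, so to first order t(⟨μ_n, p⟩ - centre) is a fixed linear combination
of their rescaled fluctuations.

First-order expansions are stored as dual numbers (`TrivSqZeroExt`): a limit together with a formal
linear combination of fluctuations. `HasJet` is stable under sums and products (`HasJet.add`,
`HasJet.mul`), so running the tridiagonal recursion over dual numbers yields the jet of the pairing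
(`hasJet_spectralPairing`). Remainders vanish in every L^k, which makes products work and lets the
centre be replaced by the expectation (`HasJet.tendsto_charFun_sub`).

The probabilistic input is integration by parts for the beta law (`integral_betaMeasure_stein`). It
bounds the central moments, and it gives an approximate Gaussian differential equation for the
characteristic function (`exists_norm_integral_cexp_betaMeasure_sub_le`). Independence then makes
the linear part asymptotically Gaussian (`tendsto_charFun_linearCombination`), and Lévy's continuity
theorem concludes. -/

section BetaDistribution

/-! ### Beta laws: integration by parts, central moments, Gaussian approximation. -/

theorem ae_mem_Ioo_betaMeasure (a b : ℝ) : ∀ᵐ x ∂betaMeasure a b, x ∈ Set.Ioo (0 : ℝ) 1 := by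
  have hm : Measurable (betaPDF a b) := (measurable_betaPDFReal a b).ennreal_ofReal
  rw [betaMeasure, ae_withDensity_iff hm]
  refine ae_of_all _ fun x hx => ?_
  constructor
  · by_contra h
    exact hx (betaPDF_eq_zero_of_nonpos (not_lt.1 h))
  · by_contra h
    exact hx (betaPDF_eq_zero_of_one_le (not_lt.1 h))

theorem integrable_betaMeasure_of_continuous {E : Type*} [NormedAddCommGroup E] {a b : ℝ}
    (ha : 0 < a) (hb : 0 < b) {f : ℝ → E} (hf : Continuous f) :
    Integrable f (betaMeasure a b) := by
  have := isProbabilityMeasureBeta ha hb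
  obtain ⟨C, hC⟩ := (isCompact_Icc (a := (0 : ℝ)) (b := 1)).exists_bound_of_continuousOn
    hf.continuousOn
  refine Integrable.of_bound hf.aestronglyMeasurable C ?_
  filter_upwards [ae_mem_Ioo_betaMeasure a b] with x hx using hC x (Set.Ioo_subset_Icc_self hx)

theorem toReal_betaPDF_of_mem {a b x : ℝ} (ha : 0 < a) (hb : 0 < b) (hx : x ∈ Set.Ioo (0 : ℝ) 1) :
    (betaPDF a b x).toReal = 1 / beta a b * (x ^ (a - 1) * (1 - x) ^ (b - 1)) := by
  have := betaPDFReal_pos hx.1 hx.2 ha hb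
  rw [betaPDF, ENNReal.toReal_ofReal this.le, betaPDFReal, if_pos ⟨hx.1, hx.2⟩, mul_assoc]

theorem integral_betaMeasure {E : Type*} [NormedAddCommGroup E] [NormedSpace ℝ E] {a b : ℝ}
    (ha : 0 < a) (hb : 0 < b) (f : ℝ → E) :
    ∫ x, f x ∂betaMeasure a b =
      (1 / beta a b) • ∫ x in (0 : ℝ)..1, (x ^ (a - 1) * (1 - x) ^ (b - 1)) • f x := by
  have hm : Measurable (betaPDF a b) := (measurable_betaPDFReal a b).ennreal_ofReal
  rw [betaMeasure, integral_withDensity_eq_integral_toReal_smul hm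
    (ae_of_all _ fun x => ENNReal.ofReal_lt_top), intervalIntegral.integral_of_le zero_le_one,
    integral_Ioc_eq_integral_Ioo, ← integral_smul,
    ← setIntegral_eq_integral_of_forall_compl_eq_zero (s := Set.Ioo 0 1)]
  · refine setIntegral_congr_fun measurableSet_Ioo fun x hx => ?_
    rw [toReal_betaPDF_of_mem ha hb hx, smul_smul]
  · intro x hx
    have : betaPDF a b x = 0 := by
      rw [betaPDF, betaPDFReal, if_neg (by simpa [Set.mem_Ioo] using hx), ENNReal.ofReal_zero]
    simp [this]

theorem intervalIntegrable_betaKernel_smul {E : Type*} [NormedAddCommGroup E] [NormedSpace ℝ E]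
    {a b : ℝ} (ha : 0 < a) (hb : 0 < b) {f : ℝ → E} (hf : Continuous f) :
    IntervalIntegrable (fun x : ℝ => (x ^ (a - 1) * (1 - x) ^ (b - 1)) • f x) volume 0 1 := by
  have h := integrable_betaMeasure_of_continuous ha hb hf
  have hm : Measurable (betaPDF a b) := (measurable_betaPDFReal a b).ennreal_ofReal
  rw [betaMeasure, integrable_withDensity_iff_integrable_smul' hm
    (ae_of_all _ fun x => ENNReal.ofReal_lt_top)] at h
  rw [intervalIntegrable_iff_integrableOn_Ioo_of_le zero_le_one]
  refine IntegrableOn.congr_fun (h.integrableOn.smul (beta a b)) (fun x hx => ?_) measurableSet_Ioo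
  have := (beta_pos ha hb).ne'
  simp only [Pi.smul_apply]
  rw [toReal_betaPDF_of_mem ha hb hx, smul_smul, ← mul_assoc, mul_one_div_cancel this, one_mul]

/-- Integration by parts for the beta distribution. -/
theorem integral_betaMeasure_stein {E : Type*} [NormedAddCommGroup E] [NormedSpace ℝ E]
    [CompleteSpace E] {a b : ℝ} (ha : 0 < a) (hb : 0 < b) {f f' : ℝ → E}
    (hf : ∀ x, HasDerivAt f (f' x) x) (hf' : Continuous f') :
    ∫ x, ((a + b) * x - a) • f x ∂betaMeasure a b =
      ∫ x, (x * (1 - x)) • f' x ∂betaMeasure a b := by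
  have hfc : Continuous f := continuous_iff_continuousAt.2 fun x => (hf x).continuousAt
  rw [← sub_eq_zero, ← integral_sub
    (integrable_betaMeasure_of_continuous ha hb (by fun_prop))
    (integrable_betaMeasure_of_continuous ha hb (by fun_prop)), integral_betaMeasure ha hb]
  have hint := intervalIntegrable_betaKernel_smul ha hb
    (f := fun x => ((a + b) * x - a) • f x - (x * (1 - x)) • f' x) (by fun_prop)
  -- The integrand is the derivative of -x^a (1 - x)^b f(x), which vanishes at both endpoints
  -- because a, b > 0.
  have key := intervalIntegral.integral_eq_sub_of_hasDerivAt_of_le zero_le_one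
    (f := fun x : ℝ => -((x ^ a * (1 - x) ^ b) • f x)) ?_ ?_ hint
  · rw [key]
    simp [Real.zero_rpow ha.ne', Real.zero_rpow hb.ne']
  · have h1 : Continuous fun x : ℝ => x ^ a := Real.continuous_rpow_const ha.le
    have h2 : Continuous fun x : ℝ => (1 - x) ^ b :=
      (Real.continuous_rpow_const hb.le).comp (by fun_prop)
    exact ((h1.mul h2).smul hfc).neg.continuousOn
  · intro x hx
    have hx0 : x ≠ 0 := hx.1.ne'
    have hx1 : 0 < 1 - x := by linarith [hx.2]
    have h1 : HasDerivAt (fun x : ℝ => x ^ a) (a * x ^ (a - 1)) x :=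
      Real.hasDerivAt_rpow_const (Or.inl hx0)
    have h2 : HasDerivAt (fun x : ℝ => (1 - x) ^ b) (-1 * b * (1 - x) ^ (b - 1)) x :=
      HasDerivAt.rpow_const ((hasDerivAt_id x).const_sub 1) (Or.inl hx1.ne')
    refine (((h1.mul h2).smul (hf x)).neg).congr_deriv ?_
    have e1 : x ^ a = x ^ (a - 1) * x := by
      rw [← Real.rpow_add_one hx0]; ring_nf
    have e2 : (1 - x) ^ b = (1 - x) ^ (b - 1) * (1 - x) := by
      rw [← Real.rpow_add_one hx1.ne']; ring_nf
    simp only [Pi.mul_apply]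
    rw [e1, e2]
    module

/-- Even central moments of a beta distribution are controlled by the variance proxy
`a / (a + b) ^ 2`. -/
theorem exists_integral_sub_pow_betaMeasure_le (j : ℕ) : ∃ C : ℝ, 0 ≤ C ∧ ∀ a b : ℝ, 1 ≤ a → 0 < b →
    ∫ x, (x - a / (a + b)) ^ (2 * j) ∂betaMeasure a b ≤ C * (a / (a + b) ^ 2) ^ j := by
  induction j with
  | zero =>
    refine ⟨1, zero_le_one, fun a b ha hb => ?_⟩
    have := isProbabilityMeasureBeta (zero_lt_one.trans_le ha) hb
    simp
  | succ j ih =>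
    obtain ⟨C, hC0, hC⟩ := ih
    refine ⟨C * (2 * (2 * j + 1) + (2 * j + 1) ^ 2), by positivity, fun a b ha hb => ?_⟩
    have ha0 : 0 < a := zero_lt_one.trans_le ha
    have hN : 0 < a + b := by positivity
    set m := a / (a + b) with hm
    -- With this test function the identity reads (a + b) M_{2j+2} = (2j + 1) E[x(1 - x)(x -
    -- m)^{2j}], a recursion for the even central moments.
    have hstein := integral_betaMeasure_stein ha0 hb (f := fun x : ℝ => (x - m) ^ (2 * j + 1))
      (f' := fun x : ℝ => (2 * j + 1) * (x - m) ^ (2 * j))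
      (fun x => by simpa using ((hasDerivAt_id x).sub_const m).fun_pow (2 * j + 1)) (by fun_prop)
    have hl : ∫ x, ((a + b) * x - a) • (x - m) ^ (2 * j + 1) ∂betaMeasure a b =
        (a + b) * ∫ x, (x - m) ^ (2 * (j + 1)) ∂betaMeasure a b := by
      rw [← integral_const_mul]
      congr 1
      ext x
      have : (a + b) * x - a = (a + b) * (x - m) := by rw [hm]; field_simp
      rw [this, smul_eq_mul]; ring
    rw [hl] at hstein
    set K : ℝ := 2 * j + 1
    -- Since x(1 - x) ≤ m + (x - m), an odd power of x - m appears. Young's inequality splits it so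
    -- that exactly half of (a + b) M_{2j+2} is absorbed by the left side.
    have hle : ∫ x, (x * (1 - x)) • (K * (x - m) ^ (2 * j)) ∂betaMeasure a b ≤
        ∫ x, ((K * m + K ^ 2 / (2 * (a + b))) * (x - m) ^ (2 * j) +
          (a + b) / 2 * (x - m) ^ (2 * (j + 1))) ∂betaMeasure a b := by
      refine integral_mono (integrable_betaMeasure_of_continuous ha0 hb (by fun_prop))
        (integrable_betaMeasure_of_continuous ha0 hb (by fun_prop)) fun x => ?_
      have hu : 0 ≤ (x - m) ^ (2 * j) := by rw [pow_mul]; positivity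
      have hK : 0 ≤ K := by positivity
      have h1 : x * (1 - x) ≤ m + (x - m) := by nlinarith [sq_nonneg x]
      have h2 : K * (x - m) ≤ (a + b) / 2 * (x - m) ^ 2 + K ^ 2 / (2 * (a + b)) := by
        have : (a + b) / 2 * (x - m) ^ 2 + K ^ 2 / (2 * (a + b)) - K * (x - m) =
            ((a + b) * (x - m) - K) ^ 2 / (2 * (a + b)) := by field_simp; ring
        have h3 : 0 ≤ ((a + b) * (x - m) - K) ^ 2 / (2 * (a + b)) := by positivity
        linarith
      have h4 : x * (1 - x) * K ≤ K * m + K ^ 2 / (2 * (a + b)) + (a + b) / 2 * (x - m) ^ 2 := by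
        nlinarith [mul_le_mul_of_nonneg_right h1 hK]
      have := mul_le_mul_of_nonneg_right h4 hu
      simp only [smul_eq_mul]
      calc _ = x * (1 - x) * K * (x - m) ^ (2 * j) := by ring
        _ ≤ _ := this
        _ = _ := by ring
    rw [integral_add (integrable_betaMeasure_of_continuous ha0 hb (by fun_prop))
      (integrable_betaMeasure_of_continuous ha0 hb (by fun_prop)), integral_const_mul,
      integral_const_mul, ← hstein] at hle
    have hj := hC a b ha hb
    rw [← hm] at hj
    set M' := ∫ x, (x - m) ^ (2 * (j + 1)) ∂betaMeasure a b
    set M := ∫ x, (x - m) ^ (2 * j) ∂betaMeasure a b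
    have hM : 0 ≤ M := integral_nonneg fun x => by simp only [Pi.zero_apply, pow_mul]; positivity
    have h5 : M' ≤ (2 * K + K ^ 2) * (a / (a + b) ^ 2) * M := by
      have h6 : M' ≤ 2 / (a + b) * ((K * m + K ^ 2 / (2 * (a + b))) * M) := by
        rw [div_mul_eq_mul_div, le_div_iff₀ hN]; linarith
      have h7 : 2 / (a + b) * (K * m + K ^ 2 / (2 * (a + b))) ≤
          (2 * K + K ^ 2) * (a / (a + b) ^ 2) := by
        have e : 2 / (a + b) * (K * m + K ^ 2 / (2 * (a + b))) =
            (2 * K * a + K ^ 2) / (a + b) ^ 2 := by rw [hm]; field_simp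
        rw [e, ← mul_div_assoc]
        gcongr
        -- Here 1 ≤ a enters, through K² ≤ K² a.
        nlinarith [sq_nonneg K]
      calc M' ≤ _ := h6
        _ = 2 / (a + b) * (K * m + K ^ 2 / (2 * (a + b))) * M := by ring
        _ ≤ _ := mul_le_mul_of_nonneg_right h7 hM
    calc M' ≤ _ := h5
      _ ≤ (2 * K + K ^ 2) * (a / (a + b) ^ 2) * (C * (a / (a + b) ^ 2) ^ j) := by gcongr
      _ = _ := by ring

theorem integral_betaMeasure_id {a b : ℝ} (ha : 0 < a) (hb : 0 < b) :
    ∫ x, x ∂betaMeasure a b = a / (a + b) := by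
  have := isProbabilityMeasureBeta ha hb
  have h := integral_betaMeasure_stein ha hb (f := fun _ => (1 : ℝ)) (f' := fun _ => 0)
    (fun x => hasDerivAt_const x 1) (by fun_prop)
  simp only [smul_eq_mul, mul_one, mul_zero, integral_zero] at h
  rw [integral_sub (integrable_betaMeasure_of_continuous ha hb (by fun_prop))
    (integrable_const a), integral_const_mul] at h
  simp only [integral_const, probReal_univ, one_smul] at h
  rw [eq_div_iff (by positivity)]
  linarith

/-- Integrate |y| ≤ y²/d + d at the scale d = √a/(a + b) suggested by the second-moment bound. -/
theorem exists_integral_abs_sub_betaMeasure_le : ∃ C : ℝ, 0 ≤ C ∧ ∀ a b : ℝ, 1 ≤ a → 0 < b →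
    ∫ x, |x - a / (a + b)| ∂betaMeasure a b ≤ C * (√a / (a + b)) := by
  obtain ⟨C, hC0, hC⟩ := exists_integral_sub_pow_betaMeasure_le 1
  refine ⟨C + 1, by positivity, fun a b ha hb => ?_⟩
  have ha0 : 0 < a := zero_lt_one.trans_le ha
  have := isProbabilityMeasureBeta ha0 hb
  have hd : 0 < √a / (a + b) := by positivity
  have hd2 : a / (a + b) ^ 2 = (√a / (a + b)) ^ 2 := by
    rw [div_pow, Real.sq_sqrt ha0.le]
  have h := hC a b ha hb
  rw [hd2, pow_one, mul_one] at h
  set d := √a / (a + b)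
  calc ∫ x, |x - a / (a + b)| ∂betaMeasure a b
      ≤ ∫ x, (d⁻¹ * (x - a / (a + b)) ^ 2 + d) ∂betaMeasure a b := by
        refine integral_mono (integrable_betaMeasure_of_continuous ha0 hb (by fun_prop))
          (integrable_betaMeasure_of_continuous ha0 hb (by fun_prop)) fun x => ?_
        set y := x - a / (a + b)
        have h1 : 0 ≤ d⁻¹ * ((|y| - d) ^ 2 + |y| * d) := by positivity
        have h2 : d⁻¹ * ((|y| - d) ^ 2 + |y| * d) = d⁻¹ * y ^ 2 + d - |y| := by
          rw [← sq_abs y]; field_simp; ring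
        linarith
    _ ≤ d⁻¹ * (C * d ^ 2) + d := by
        rw [integral_add (integrable_betaMeasure_of_continuous ha0 hb (by fun_prop))
          (integrable_const _), integral_const_mul]
        simp only [integral_const, probReal_univ, one_smul]
        gcongr
    _ = _ := by field_simp

theorem hasDerivAt_integral_cexp_betaMeasure {a b : ℝ} (ha : 0 < a) (hb : 0 < b) (τ m u : ℝ) :
    HasDerivAt (fun u : ℝ => ∫ x : ℝ, Complex.exp (u * (τ * (x - m)) * Complex.I) ∂betaMeasure a b)
      (∫ x : ℝ, (τ * (x - m)) * Complex.I * Complex.exp (u * (τ * (x - m)) * Complex.I)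
        ∂betaMeasure a b) u := by
  refine (hasDerivAt_integral_of_dominated_loc_of_deriv_le (bound := fun x => |τ * (x - m)|)
    (F := fun u x : ℝ => Complex.exp (u * (τ * (x - m)) * Complex.I))
    (F' := fun u x : ℝ => (τ * (x - m)) * Complex.I * Complex.exp (u * (τ * (x - m)) * Complex.I))
    univ_mem (Eventually.of_forall fun v => Continuous.aestronglyMeasurable (by fun_prop))
    (integrable_betaMeasure_of_continuous ha hb (by fun_prop))
    (Continuous.aestronglyMeasurable (by fun_prop)) (ae_of_all _ fun x v _ => ?_)
    (integrable_betaMeasure_of_continuous ha hb (by fun_prop))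
    (ae_of_all _ fun x v _ => ?_)).2
  · have e : Complex.exp (v * (τ * (x - m)) * Complex.I) =
        Complex.exp ((v * (τ * (x - m)) : ℝ) * Complex.I) := by push_cast; rfl
    rw [e, norm_mul, Complex.norm_exp_ofReal_mul_I, mul_one, norm_mul, Complex.norm_I, mul_one]
    exact_mod_cast le_rfl
  · have h1 : HasDerivAt (fun v : ℝ => (v : ℂ) * (τ * (x - m)) * Complex.I)
        (1 * (τ * (x - m)) * Complex.I) v :=
      ((Complex.ofRealCLM.hasDerivAt (x := v)).mul_const _).mul_const _
    exact h1.cexp.congr_deriv (by ring)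

/-- Integration by parts gives φ'(u) = -(uτ²/(a + b)) E[x(1 - x) e^{iuτ(x - m)}]. Replacing x(1 - x)
by m(1 - m) would give the Gaussian equation φ' = -wuφ. The replacement costs at most E|x - m|,
since |1 - x - m| ≤ 1 on (0, 1). -/
theorem exists_norm_integral_cexp_betaMeasure_sub_le : ∃ C : ℝ, 0 ≤ C ∧
    ∀ a b τ u : ℝ, 1 ≤ a → 0 < b →
    ‖(∫ x : ℝ, Complex.exp (u * (τ * (x - (a / (a + b) : ℝ))) * Complex.I) ∂betaMeasure a b) -
      Complex.exp (-((τ ^ 2 * a / (a + b) ^ 2 * (b / (a + b)) : ℝ) * (u : ℂ) ^ 2 / 2))‖ ≤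
      C * u ^ 2 * (τ ^ 2 * a / (a + b) ^ 2) / √a := by
  obtain ⟨C, hC0, hC⟩ := exists_integral_abs_sub_betaMeasure_le
  refine ⟨C, hC0, fun a b τ U ha hb => ?_⟩
  have ha0 : 0 < a := zero_lt_one.trans_le ha
  have := isProbabilityMeasureBeta ha0 hb
  have hN : 0 < a + b := by positivity
  set m := a / (a + b) with hm
  set w := τ ^ 2 * a / (a + b) ^ 2 * (b / (a + b)) with hw
  have hw0 : 0 ≤ w := by positivity
  have hwm : w = τ ^ 2 / (a + b) * (m * (1 - m)) := by rw [hw, hm]; field_simp; ring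
  set μ := betaMeasure a b with hμ
  have hm01 : 0 ≤ m ∧ m ≤ 1 := ⟨by positivity, by rw [hm, div_le_one hN]; linarith⟩
  set e : ℝ → ℝ → ℂ := fun u x => Complex.exp (u * (τ * (x - m)) * Complex.I) with he
  have hec : ∀ u, Continuous (e u) := fun u => by rw [he]; fun_prop
  have hnorm : ∀ u x, ‖e u x‖ = 1 := fun u x => by
    rw [he, ← Complex.norm_exp_ofReal_mul_I (u * (τ * (x - m)))]; push_cast; rfl
  have hi : ∀ {f : ℝ → ℂ}, Continuous f → Integrable f μ := fun hf =>
    integrable_betaMeasure_of_continuous ha0 hb hf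
  set φ : ℝ → ℂ := fun u => ∫ x, e u x ∂μ with hφ
  have hφ' : ∀ u : ℝ, HasDerivAt φ (-(u * τ ^ 2 / (a + b) * ∫ x, (x * (1 - x) : ℝ) • e u x ∂μ)) u := by
    intro u
    refine (hasDerivAt_integral_cexp_betaMeasure ha0 hb τ m u).congr_deriv ?_
    have hst := integral_betaMeasure_stein ha0 hb (f := e u)
      (f' := fun x => (u * τ * Complex.I) * e u x) (fun x => ?_) (continuous_const.mul (hec u))
    · have h1 : ∫ x : ℝ, (τ * (x - m)) * Complex.I * e u x ∂μ =
          (τ * Complex.I / (a + b)) * ∫ x, ((a + b) * x - a) • e u x ∂μ := by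
        rw [← integral_const_mul]
        congr 1
        ext x
        have hN' : (a + b : ℂ) ≠ 0 := by exact_mod_cast hN.ne'
        rw [Complex.real_smul, hm]
        push_cast
        field_simp
      rw [h1, hst]
      have h2 : ∫ x : ℝ, (x * (1 - x)) • ((u * τ * Complex.I) * e u x) ∂μ =
          (u * τ * Complex.I) * ∫ x, (x * (1 - x) : ℝ) • e u x ∂μ := by
        rw [← integral_const_mul]
        congr 1
        ext x
        rw [mul_smul_comm]
      rw [h2]
      linear_combination (τ ^ 2 * u / (a + b) * ∫ x, (x * (1 - x) : ℝ) • e u x ∂μ) * Complex.I_sq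
    · have h1 : HasDerivAt (fun x : ℝ => (u : ℂ) * (τ * (x - m)) * Complex.I)
          (u * (τ * 1) * Complex.I) x :=
        ((((Complex.ofRealCLM.hasDerivAt (x := x)).sub_const _).const_mul _).const_mul _).mul_const _
      exact h1.cexp.congr_deriv (by simp only [he]; ring)
  -- Integrating factor: the Gaussian part of the equation cancels, so ψ' contains only the
  -- replacement error.
  set ψ : ℝ → ℂ := fun u => φ u * Complex.exp (w * (u : ℂ) ^ 2 / 2) with hψ
  have hψ' : ∀ u : ℝ, HasDerivAt ψ (-(u * τ ^ 2 / (a + b)) * Complex.exp (w * (u : ℂ) ^ 2 / 2) *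
      ∫ x, ((x * (1 - x) - m * (1 - m) : ℝ)) • e u x ∂μ) u := by
    intro u
    have h1 : HasDerivAt (fun u : ℝ => (w : ℂ) * (u : ℂ) ^ 2 / 2) ((w : ℂ) * u) u := by
      have := ((((Complex.ofRealCLM.hasDerivAt (x := u)).fun_pow 2).const_mul (w : ℂ)).div_const 2)
      refine this.congr_deriv ?_
      simp
      ring
    refine ((hφ' u).mul h1.cexp).congr_deriv ?_
    have h2 : ∫ x, ((x * (1 - x) - m * (1 - m) : ℝ)) • e u x ∂μ =
        (∫ x, (x * (1 - x) : ℝ) • e u x ∂μ) - (m * (1 - m) : ℝ) * φ u := by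
      rw [hφ]
      simp only
      rw [← integral_const_mul, ← integral_sub (hi (by fun_prop)) (hi (by fun_prop))]
      congr 1
      ext x
      rw [sub_smul, Complex.real_smul, Complex.real_smul]
    rw [h2, hwm]
    push_cast
    ring
  have hbound : ∀ u ∈ Metric.closedBall (0 : ℝ) |U|,
      ‖-(u * τ ^ 2 / (a + b)) * Complex.exp (w * (u : ℂ) ^ 2 / 2) *
        ∫ x, ((x * (1 - x) - m * (1 - m) : ℝ)) • e u x ∂μ‖ ≤
      (|U| * τ ^ 2 / (a + b)) * Real.exp (w * U ^ 2 / 2) * (C * (√a / (a + b))) := by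
    intro u hu
    rw [mem_closedBall_zero_iff, Real.norm_eq_abs] at hu
    have h1 : ‖(-(u * τ ^ 2 / (a + b)) : ℂ)‖ ≤ |U| * τ ^ 2 / (a + b) := by
      have : (-(u * τ ^ 2 / (a + b)) : ℂ) = ((-(u * τ ^ 2 / (a + b)) : ℝ) : ℂ) := by push_cast; rfl
      rw [this, Complex.norm_real, Real.norm_eq_abs, abs_neg, abs_div, abs_mul, abs_of_pos hN,
        abs_of_nonneg (sq_nonneg τ)]
      gcongr
    have h2 : ‖Complex.exp (w * (u : ℂ) ^ 2 / 2)‖ ≤ Real.exp (w * U ^ 2 / 2) := by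
      have : (w * (u : ℂ) ^ 2 / 2) = ((w * u ^ 2 / 2 : ℝ) : ℂ) := by push_cast; rfl
      rw [this, Complex.norm_exp_ofReal]
      have : u ^ 2 ≤ U ^ 2 := sq_le_sq.2 hu
      gcongr
    have h3 : ‖∫ x, ((x * (1 - x) - m * (1 - m) : ℝ)) • e u x ∂μ‖ ≤ C * (√a / (a + b)) := by
      refine le_trans ?_ (hC a b ha hb)
      refine norm_integral_le_of_norm_le (integrable_betaMeasure_of_continuous ha0 hb
        (by fun_prop)) ?_
      filter_upwards [ae_mem_Ioo_betaMeasure a b] with x hx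
      rw [norm_smul, hnorm, mul_one, Real.norm_eq_abs]
      have : x * (1 - x) - m * (1 - m) = (x - m) * (1 - x - m) := by ring
      rw [this, abs_mul]
      refine mul_le_of_le_one_right (abs_nonneg _) (abs_le.2 ⟨?_, ?_⟩) <;>
        linarith [hx.1, hx.2, hm01.1, hm01.2]
    rw [norm_mul, norm_mul]
    gcongr
  -- The mean value inequality on |u| ≤ |U| loses the factor e^{wU²/2}, which multiplication by
  -- e^{-wU²/2} removes exactly when returning from ψ to φ.
  have hmv := Convex.norm_image_sub_le_of_norm_hasDerivWithin_le
    (fun u _ => (hψ' u).hasDerivWithinAt) hbound (convex_closedBall (0 : ℝ) |U|)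
    (Metric.mem_closedBall_self (abs_nonneg U)) (y := U) (by simp)
  have hψ0 : ψ 0 = 1 := by simp [hψ, hφ, he]
  rw [hψ0, sub_zero, Real.norm_eq_abs] at hmv
  have hfac : φ U - Complex.exp (-(w * (U : ℂ) ^ 2 / 2)) =
      (ψ U - 1) * Complex.exp (-(w * (U : ℂ) ^ 2 / 2)) := by
    rw [hψ, sub_mul, mul_assoc, ← Complex.exp_add]; simp
  have hn : ‖Complex.exp (-(w * (U : ℂ) ^ 2 / 2))‖ = Real.exp (-(w * U ^ 2 / 2)) := by
    rw [← Complex.norm_exp_ofReal]; push_cast; rfl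
  change ‖φ U - Complex.exp (-(w * (U : ℂ) ^ 2 / 2))‖ ≤ _
  rw [hfac, norm_mul, hn]
  calc _ ≤ (|U| * τ ^ 2 / (a + b) * Real.exp (w * U ^ 2 / 2) * (C * (√a / (a + b))) * |U|) *
        Real.exp (-(w * U ^ 2 / 2)) := by gcongr
    _ = |U| ^ 2 * τ ^ 2 / (a + b) * (C * (√a / (a + b))) *
        (Real.exp (w * U ^ 2 / 2) * Real.exp (-(w * U ^ 2 / 2))) := by ring
    _ = C * U ^ 2 * (τ ^ 2 * a / (a + b) ^ 2) / √a := by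
        rw [← Real.exp_add, add_neg_cancel, Real.exp_zero, mul_one, sq_abs]
        have hs : √a * √a = a := Real.mul_self_sqrt ha0.le
        have hs0 : 0 < √a := Real.sqrt_pos.2 ha0
        rw [eq_div_iff hs0.ne']
        field_simp
        rw [Real.sq_sqrt ha0.le]
        ring

end BetaDistribution

/-! ### Calculus of random first-order expansions. -/

section MomentCalculus

variable {ι : Type*} {Ω : ι → Type*} [∀ i, MeasurableSpace (Ω i)]

/-- All moments of the random variables `Y i` are eventually bounded along `l`. -/
def MomentBounded (P : ∀ i, Measure (Ω i)) (l : Filter ι) (Y : ∀ i, Ω i → ℝ) : Prop :=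
  (∀ᶠ i in l, AEStronglyMeasurable (Y i) (P i)) ∧
    ∀ k : ℕ, 1 ≤ k → ∃ C : ℝ≥0, ∀ᶠ i in l, eLpNorm (Y i) k (P i) ≤ C

/-- All absolute moments of the random variables `Y i` tend to zero along `l`. -/
def MomentNegligible (P : ∀ i, Measure (Ω i)) (l : Filter ι) (Y : ∀ i, Ω i → ℝ) : Prop :=
  (∀ᶠ i in l, AEStronglyMeasurable (Y i) (P i)) ∧
    ∀ k : ℕ, 1 ≤ k → Tendsto (fun i => eLpNorm (Y i) k (P i)) l (𝓝 0)

variable {P : ∀ i, Measure (Ω i)} {l : Filter ι} {Y Y' : ∀ i, Ω i → ℝ}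

/-- Each product doubles the exponent. This is why boundedness and negligibility are required for
all moments at once: only then are they stable under multiplication. -/
theorem eLpNorm_mul_le_two_mul {α : Type*} [MeasurableSpace α] {μ : Measure α} {f g : α → ℝ}
    (hf : AEStronglyMeasurable f μ) (hg : AEStronglyMeasurable g μ) {k : ℕ} :
    eLpNorm (f * g) k μ ≤ eLpNorm f (2 * k : ℕ) μ * eLpNorm g (2 * k : ℕ) μ := by
  have : ENNReal.HolderTriple ((2 * k : ℕ) : ℝ≥0∞) ((2 * k : ℕ) : ℝ≥0∞) (k : ℝ≥0∞) := by
    constructor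
    rw [Nat.cast_mul, Nat.cast_ofNat, ENNReal.mul_inv (by simp) (by simp), ← add_mul,
      ENNReal.inv_two_add_inv_two, one_mul]
  rw [← smul_eq_mul]
  exact eLpNorm_smul_le_mul_eLpNorm (p := ((2 * k : ℕ) : ℝ≥0∞)) (q := ((2 * k : ℕ) : ℝ≥0∞)) hg hf

theorem MomentNegligible.momentBounded (h : MomentNegligible P l Y) : MomentBounded P l Y := by
  refine ⟨h.1, fun k hk => ⟨1, ?_⟩⟩
  filter_upwards [(h.2 k hk).eventually (ge_mem_nhds zero_lt_one)] with i hi using by simpa using hi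

theorem MomentNegligible.congr (h : MomentNegligible P l Y)
    (he : ∀ᶠ i in l, Y i =ᵐ[P i] Y' i) : MomentNegligible P l Y' := by
  constructor
  · filter_upwards [h.1, he] with i hi hei using hi.congr hei
  · intro k hk
    refine (h.2 k hk).congr' ?_
    filter_upwards [he] with i hi using eLpNorm_congr_ae hi

theorem MomentNegligible.add (h : MomentNegligible P l Y) (h' : MomentNegligible P l Y') :
    MomentNegligible P l (Y + Y') := by
  constructor
  · filter_upwards [h.1, h'.1] with i hi hi' using hi.add hi'
  · intro k hk
    have := (h.2 k hk).add (h'.2 k hk)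
    rw [add_zero] at this
    refine tendsto_of_tendsto_of_tendsto_of_le_of_le' tendsto_const_nhds this
      (Eventually.of_forall fun _ => zero_le) ?_
    filter_upwards [h.1, h'.1] with i hi hi' using eLpNorm_add_le hi hi' (by exact_mod_cast hk)

theorem MomentBounded.add (h : MomentBounded P l Y) (h' : MomentBounded P l Y') :
    MomentBounded P l (Y + Y') := by
  constructor
  · filter_upwards [h.1, h'.1] with i hi hi' using hi.add hi'
  · intro k hk
    obtain ⟨C, hC⟩ := h.2 k hk
    obtain ⟨C', hC'⟩ := h'.2 k hk
    refine ⟨C + C', ?_⟩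
    filter_upwards [h.1, h'.1, hC, hC'] with i hi hi' h1 h2
    refine (eLpNorm_add_le hi hi' (by exact_mod_cast hk)).trans ?_
    push_cast
    gcongr

theorem MomentBounded.mul (h : MomentBounded P l Y) (h' : MomentBounded P l Y') :
    MomentBounded P l (Y * Y') := by
  constructor
  · filter_upwards [h.1, h'.1] with i hi hi' using hi.mul hi'
  · intro k hk
    obtain ⟨C, hC⟩ := h.2 (2 * k) (by omega)
    obtain ⟨C', hC'⟩ := h'.2 (2 * k) (by omega)
    refine ⟨C * C', ?_⟩
    filter_upwards [h.1, h'.1, hC, hC'] with i hi hi' h1 h2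
    refine (eLpNorm_mul_le_two_mul hi hi').trans ?_
    push_cast at *
    gcongr

theorem MomentNegligible.mul (h : MomentNegligible P l Y) (h' : MomentBounded P l Y') :
    MomentNegligible P l (Y * Y') := by
  constructor
  · filter_upwards [h.1, h'.1] with i hi hi' using hi.mul hi'
  · intro k hk
    obtain ⟨C, hC⟩ := h'.2 (2 * k) (by omega)
    have := ENNReal.Tendsto.mul_const (b := (C : ℝ≥0∞)) (h.2 (2 * k) (by omega)) (by simp)
    rw [zero_mul] at this
    refine tendsto_of_tendsto_of_tendsto_of_le_of_le' tendsto_const_nhds this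
      (Eventually.of_forall fun _ => zero_le) ?_
    filter_upwards [h.1, h'.1, hC] with i hi hi' h1
    exact (eLpNorm_mul_le_two_mul hi hi').trans (by gcongr)

theorem MomentNegligible.tendsto_integral_abs (h : MomentNegligible P l Y) :
    Tendsto (fun i => ∫ ω, |Y i ω| ∂P i) l (𝓝 0) := by
  have h1 := (ENNReal.tendsto_toReal ENNReal.zero_ne_top).comp (h.2 1 le_rfl)
  refine h1.congr' ?_
  filter_upwards [h.1] with i hi
  simp only [Function.comp, Nat.cast_one, eLpNorm_one_eq_lintegral_enorm]
  rw [← integral_norm_eq_lintegral_enorm hi]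
  rfl

/-- `Y` has the first order expansion `t (Y - m) = ∑ c a * Z a + o(1)` in all `L ^ k`, where
`m → q.fst` and `c = q.snd`; the dual number `q` is the first order jet of `Y`. -/
def HasJet {κ : Type*} (P : ∀ i, Measure (Ω i)) (l : Filter ι) (t : ι → ℝ)
    (Z : κ → ∀ i, Ω i → ℝ) (Y : ∀ i, Ω i → ℝ) (q : TrivSqZeroExt ℝ (κ →₀ ℝ)) : Prop :=
  ∃ m : ι → ℝ, Tendsto m l (𝓝 q.fst) ∧ MomentNegligible P l
    (fun i ω => t i * (Y i ω - m i) - Finsupp.linearCombination ℝ (fun a => Z a i ω) q.snd)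

variable {κ : Type*} {t : ι → ℝ} {Z : κ → ∀ i, Ω i → ℝ} {q q' : TrivSqZeroExt ℝ (κ →₀ ℝ)}

theorem HasJet.congr (h : HasJet P l t Z Y q) (he : ∀ᶠ i in l, Y i =ᵐ[P i] Y' i) :
    HasJet P l t Z Y' q := by
  obtain ⟨m, hm, hR⟩ := h
  refine ⟨m, hm, hR.congr ?_⟩
  filter_upwards [he] with i hi
  filter_upwards [hi] with ω hω
  rw [hω]

theorem HasJet.add (h : HasJet P l t Z Y q) (h' : HasJet P l t Z Y' q') :
    HasJet P l t Z (Y + Y') (q + q') := by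
  obtain ⟨m, hm, hR⟩ := h
  obtain ⟨m', hm', hR'⟩ := h'
  refine ⟨m + m', by simpa using! hm.add hm', (hR.add hR').congr ?_⟩
  refine Eventually.of_forall fun i => Eventually.of_forall fun ω => ?_
  simp only [Pi.add_apply, TrivSqZeroExt.snd_add, map_add]
  ring

variable [∀ i, IsProbabilityMeasure (P i)]

theorem momentNegligible_const {m : ι → ℝ} (hm : Tendsto m l (𝓝 0)) :
    MomentNegligible P l (fun i _ => m i) := by
  refine ⟨Eventually.of_forall fun i => aestronglyMeasurable_const, fun k hk => ?_⟩
  have : ∀ i, eLpNorm (fun _ : Ω i => m i) k (P i) = ‖m i‖ₑ := fun i => by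
    rw [eLpNorm_const' _ (by simpa using Nat.one_le_iff_ne_zero.1 hk) (by simp)]; simp
  simp only [this]
  simpa using hm.enorm

theorem momentBounded_const {m : ι → ℝ} {y : ℝ} (hm : Tendsto m l (𝓝 y)) :
    MomentBounded P l (fun i _ => m i) := by
  refine ⟨Eventually.of_forall fun i => aestronglyMeasurable_const, fun k hk => ?_⟩
  have : ∀ i, eLpNorm (fun _ : Ω i => m i) k (P i) = ‖m i‖ₑ := fun i => by
    rw [eLpNorm_const' _ (by simpa using Nat.one_le_iff_ne_zero.1 hk) (by simp)]; simp
  simp only [this]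
  refine ⟨‖y‖₊ + 1, ?_⟩
  have h1 : ∀ᶠ i in l, ‖m i‖₊ ≤ ‖y‖₊ + 1 := hm.nnnorm.eventually (ge_mem_nhds (by simp))
  filter_upwards [h1] with i hi
  rw [← ENNReal.coe_le_coe] at hi
  exact hi

theorem MomentBounded.linearCombination
    (hZ : ∀ a, MomentBounded P l (Z a)) (c : κ →₀ ℝ) :
    MomentBounded P l (fun i ω => Finsupp.linearCombination ℝ (fun a => Z a i ω) c) := by
  induction c using Finsupp.induction_linear with
  | zero => simpa using momentBounded_const (m := fun _ => (0 : ℝ)) tendsto_const_nhds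
  | add f g hf hg => simpa using! hf.add hg
  | single a r =>
    simpa using! (momentBounded_const (m := fun _ => r) tendsto_const_nhds).mul (hZ a)

theorem hasJet_const {m : ι → ℝ} {y : ℝ} (hm : Tendsto m l (𝓝 y)) :
    HasJet P l t Z (fun i _ => m i) (TrivSqZeroExt.inl y) :=
  ⟨m, by simpa using hm, by
    simpa using momentNegligible_const (m := fun _ => (0 : ℝ)) tendsto_const_nhds⟩

/-- Leibniz rule. With Y = m + U/t and Y' = m' + U'/t, one has t(YY' - mm') = mU' + m'U + UU'/t. The
last term vanishes as t → ∞, and m, m' may be replaced by their limits in front of the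
moment-bounded linear parts; this is multiplication of dual numbers. -/
theorem HasJet.mul (hZ : ∀ a, MomentBounded P l (Z a)) (ht : Tendsto t l atTop)
    (h : HasJet P l t Z Y q) (h' : HasJet P l t Z Y' q') :
    HasJet P l t Z (Y * Y') (q * q') := by
  obtain ⟨m, hm, hR⟩ := h
  obtain ⟨m', hm', hR'⟩ := h'
  have hL := MomentBounded.linearCombination hZ q.snd
  have hL' := MomentBounded.linearCombination hZ q'.snd
  have hU := hL.add hR.momentBounded
  have hU' := hL'.add hR'.momentBounded
  have hinv : MomentNegligible P l (fun i _ => (t i)⁻¹) :=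
    momentNegligible_const ht.inv_tendsto_atTop
  have hd : MomentNegligible P l (fun i _ => m i - q.fst) :=
    momentNegligible_const (by simpa using hm.sub_const q.fst)
  have hd' : MomentNegligible P l (fun i _ => m' i - q'.fst) :=
    momentNegligible_const (by simpa using hm'.sub_const q'.fst)
  refine ⟨m * m', by simpa using! hm.mul hm', ((((hR'.mul (momentBounded_const hm)).add
    (hR.mul (momentBounded_const hm'))).add ((hd.mul hL').add (hd'.mul hL))).add
    (hinv.mul (hU.mul hU'))).congr ?_⟩
  refine Eventually.of_forall fun i => Eventually.of_forall fun ω => ?_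
  simp only [Pi.add_apply, Pi.mul_apply, TrivSqZeroExt.snd_mul, map_add, map_smul,
    op_smul_eq_smul, smul_eq_mul]
  -- If t i = 0, its inverse is 0 by convention; the identity still holds, since t(Y - m) and t(Y' -
  -- m') vanish.
  by_cases h0 : t i = 0
  · simp [h0]; ring
  · field_simp; ring

theorem HasJet.sub (hZ : ∀ a, MomentBounded P l (Z a)) (ht : Tendsto t l atTop)
    (h : HasJet P l t Z Y q) (h' : HasJet P l t Z Y' q') :
    HasJet P l t Z (Y - Y') (q - q') := by
  have h1 := (hasJet_const (P := P) (t := t) (Z := Z) (m := fun _ => -1)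
    (tendsto_const_nhds (f := l))).mul hZ ht h'
  have e1 : Y - Y' = Y + (fun i _ => -1) * Y' := by
    funext i ω
    simp [sub_eq_add_neg]
  have e2 : q - q' = q + TrivSqZeroExt.inl (-1) * q' :=
    TrivSqZeroExt.ext (by simp [sub_eq_add_neg]) (by simp [sub_eq_add_neg])
  rw [e1, e2]
  exact h.add h1

theorem hasJet_of_affine {a : κ} {m : ι → ℝ} {y : ℝ} (hm : Tendsto m l (𝓝 y))
    (h : ∀ᶠ i in l, (fun ω => t i * (Y i ω - m i)) =ᵐ[P i] Z a i) :
    HasJet P l t Z Y (TrivSqZeroExt.inl y + TrivSqZeroExt.inr (Finsupp.single a 1)) := by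
  refine ⟨m, by simpa using hm,
    (momentNegligible_const (m := fun _ => (0 : ℝ)) tendsto_const_nhds).congr ?_⟩
  filter_upwards [h] with i hi
  filter_upwards [hi] with ω hω
  rw [hω]
  simp

theorem norm_charFun_map_sub_le {α : Type*} [MeasurableSpace α] {μ : Measure α}
    [IsProbabilityMeasure μ] {f g : α → ℝ} (hf : AEMeasurable f μ) (hg : AEMeasurable g μ)
    (hfg : Integrable (fun x => f x - g x) μ) (u : ℝ) :
    ‖charFun (μ.map f) u - charFun (μ.map g) u‖ ≤ |u| * ∫ x, |f x - g x| ∂μ := by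
  have hc : Continuous fun x : ℝ => Complex.exp (u * x * Complex.I) := by fun_prop
  have hb : ∀ x : ℝ, ‖Complex.exp (u * x * Complex.I)‖ = 1 := fun x => by
    rw [← Complex.norm_exp_ofReal_mul_I (u * x)]; push_cast; rfl
  have hi : ∀ {h : α → ℝ}, AEMeasurable h μ →
      Integrable (fun x => Complex.exp (u * h x * Complex.I)) μ := fun hh =>
    Integrable.of_bound (hc.comp_aestronglyMeasurable hh.aestronglyMeasurable) 1
      (ae_of_all _ fun x => (hb _).le)
  rw [charFun_apply_real, charFun_apply_real, integral_map hf hc.aestronglyMeasurable,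
    integral_map hg hc.aestronglyMeasurable, ← integral_sub (hi hf) (hi hg), ← integral_const_mul]
  refine norm_integral_le_of_norm_le (hfg.abs.const_mul |u|) (ae_of_all _ fun x => ?_)
  have e : Complex.exp (u * f x * Complex.I) - Complex.exp (u * g x * Complex.I) =
      Complex.exp (u * g x * Complex.I) *
        (Complex.exp (Complex.I * (u * (f x - g x) : ℝ)) - 1) := by
    rw [mul_sub, ← Complex.exp_add, mul_one]
    congr 2
    push_cast
    ring
  rw [e, norm_mul, hb, one_mul, ← abs_mul]
  exact Real.norm_exp_I_mul_ofReal_sub_one_le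

/-- The centred and rescaled variable has asymptotically the same characteristic function as the
linear part of its jet. -/
theorem HasJet.tendsto_charFun_sub (h : HasJet P l t Z Y q)
    (hZ : ∀ a, MomentBounded P l (Z a)) (hZ0 : ∀ a, ∀ᶠ i in l, ∫ ω, Z a i ω ∂P i = 0)
    (hY : ∀ i, Integrable (Y i) (P i)) (u : ℝ) :
    Tendsto (fun i => charFun ((P i).map fun ω => t i * (Y i ω - ∫ ω', Y i ω' ∂P i)) u -
      charFun ((P i).map fun ω => Finsupp.linearCombination ℝ (fun a => Z a i ω) q.snd) u)
      l (𝓝 0) := by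
  obtain ⟨m, hm, hR⟩ := h
  set L : ∀ i, Ω i → ℝ := fun i ω => Finsupp.linearCombination ℝ (fun a => Z a i ω) q.snd with hLdef
  set R : ∀ i, Ω i → ℝ := fun i ω => t i * (Y i ω - m i) - L i ω with hRdef
  have hZi : ∀ a, ∀ᶠ i in l, Integrable (Z a i) (P i) := fun a => by
    obtain ⟨C, hC⟩ := (hZ a).2 1 le_rfl
    filter_upwards [hC, (hZ a).1] with i hi hi'
    rw [← memLp_one_iff_integrable]
    exact ⟨hi', lt_of_le_of_lt (by simpa using hi) ENNReal.coe_lt_top⟩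
  have hL : ∀ᶠ i in l, Integrable (L i) (P i) ∧ ∫ ω, L i ω ∂P i = 0 := by
    have h1 : ∀ᶠ i in l, ∀ a ∈ q.snd.support, Integrable (Z a i) (P i) ∧ ∫ ω, Z a i ω ∂P i = 0 :=
      (Finset.eventually_all _).2 fun a _ => (hZi a).and (hZ0 a)
    filter_upwards [h1] with i hi
    simp only [hLdef, Finsupp.linearCombination_apply, Finsupp.sum, smul_eq_mul]
    refine ⟨integrable_finsetSum _ fun a ha => (hi a ha).1.const_mul _, ?_⟩
    rw [integral_finsetSum _ fun a ha => (hi a ha).1.const_mul _]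
    exact Finset.sum_eq_zero fun a ha => by rw [integral_const_mul, (hi a ha).2, mul_zero]
  have hlim : Tendsto (fun i => |u| * (2 * ∫ ω, |R i ω| ∂P i)) l (𝓝 0) := by
    simpa using (hR.tendsto_integral_abs.const_mul 2).const_mul |u|
  refine squeeze_zero_norm' ?_ hlim
  filter_upwards [hL] with i ⟨hLi, hL0⟩
  have hYm : Integrable (fun ω => t i * (Y i ω - m i)) (P i) :=
    ((hY i).sub (integrable_const _)).const_mul _
  have hRi : Integrable (R i) (P i) := by
    exact hYm.sub hLi
  have hRint : ∫ ω, R i ω ∂P i = t i * (∫ ω, Y i ω ∂P i - m i) := by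
    simp only [hRdef]
    rw [integral_sub hYm hLi, hL0, sub_zero,
      integral_const_mul, integral_sub (hY i) (integrable_const _)]
    simp
  -- The linear part is centred, so passing from the centre m i to the true mean subtracts exactly
  -- the mean of the remainder R. Smallness of R in L¹ is therefore enough.
  have hdiff : ∀ ω, t i * (Y i ω - ∫ ω', Y i ω' ∂P i) - L i ω = R i ω - ∫ ω', R i ω' ∂P i := by
    intro ω
    rw [hRint]
    simp only [hRdef]
    ring
  refine (norm_charFun_map_sub_le
    (((hY i).sub (integrable_const _)).const_mul _).aemeasurable hLi.aemeasurable
    ((((hY i).sub (integrable_const _)).const_mul _).sub hLi) u).trans ?_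
  refine mul_le_mul_of_nonneg_left ?_ (abs_nonneg u)
  change ∫ ω, |t i * (Y i ω - ∫ ω', Y i ω' ∂P i) - L i ω| ∂P i ≤ _
  simp only [hdiff]
  calc ∫ ω, |R i ω - ∫ ω', R i ω' ∂P i| ∂P i
      ≤ ∫ ω, (|R i ω| + ∫ ω', |R i ω'| ∂P i) ∂P i := by
        refine integral_mono (hRi.sub (integrable_const _)).abs
          (hRi.abs.add (integrable_const _)) fun ω => ?_
        have := abs_integral_le_integral_abs (f := R i) (μ := P i)
        exact (abs_sub _ _).trans (by gcongr)
    _ = 2 * ∫ ω, |R i ω| ∂P i := by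
        rw [integral_add hRi.abs (integrable_const _)]
        simp
        ring

end MomentCalculus

/-! ### Entries of powers of tridiagonal matrices as polynomials in the coefficients. -/

section TridiagonalPowers

/-- The first column of the `k`-th power of the infinite tridiagonal matrix with diagonal
`a 1, a 2, …`, superdiagonal `d 1, d 2, …` and subdiagonal `1, 1, …`. -/
def tridiagonalPowCol {R : Type*} [CommRing R] (a d : ℕ → R) : ℕ → ℕ → R
  | 0, i => if i = 0 then 1 else 0
  | k + 1, 0 => a 1 * tridiagonalPowCol a d k 0 + d 1 * tridiagonalPowCol a d k 1
  | k + 1, i + 1 => a (i + 2) * tridiagonalPowCol a d k (i + 1) +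
      d (i + 2) * tridiagonalPowCol a d k (i + 2) + tridiagonalPowCol a d k i

theorem tridiagonalPowCol_eq_zero {R : Type*} [CommRing R] (a d : ℕ → R) {k i : ℕ} (h : k < i) :
    tridiagonalPowCol a d k i = 0 := by
  induction k generalizing i with
  | zero => simp [tridiagonalPowCol, h.ne']
  | succ k ih =>
    obtain ⟨j, rfl⟩ : ∃ j, i = j + 1 := ⟨i - 1, by omega⟩
    simp [tridiagonalPowCol, ih (show k < j + 1 by omega), ih (show k < j + 2 by omega),
      ih (show k < j by omega)]

/-- Serves to evaluate at a sample point the recursion run over a ring of random variables. -/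
theorem map_tridiagonalPowCol {R S : Type*} [CommRing R] [CommRing S] (f : R →+* S) (a d : ℕ → R)
    (k i : ℕ) : f (tridiagonalPowCol a d k i) =
      tridiagonalPowCol (fun j => f (a j)) (fun j => f (d j)) k i := by
  induction k generalizing i with
  | zero => simp only [tridiagonalPowCol]; split_ifs <;> simp
  | succ k ih => cases i <;> simp [tridiagonalPowCol, ih]

/-- Finite propagation: entry i of the k-th column does not feel superdiagonal coefficients of index
n or beyond when k + i ≤ n. Agreement there cannot be expected, because s_n carries no constraint.
-/
theorem tridiagonalPowCol_congr {R : Type*} [CommRing R] {a a' d d' : ℕ → R}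
    (ha : ∀ i, a (i + 1) = a' (i + 1)) {n : ℕ} (hd : ∀ i, i + 1 < n → d (i + 1) = d' (i + 1))
    {k i : ℕ} (h : k + i ≤ n) :
    tridiagonalPowCol a d k i = tridiagonalPowCol a' d' k i := by
  induction k generalizing i with
  | zero => rfl
  | succ k ih =>
    have hkey : ∀ j, k + 1 + j ≤ n → d (j + 1) * tridiagonalPowCol a d k (j + 1) =
        d' (j + 1) * tridiagonalPowCol a' d' k (j + 1) := fun j hj => by
      -- For k = 0 the index j + 1 may equal n, but its coefficient then multiplies a zero entry.
      rcases Nat.eq_zero_or_pos k with rfl | hk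
      · simp [tridiagonalPowCol]
      · rw [hd j (by omega), ih (by omega)]
    cases i with
    | zero => rw [tridiagonalPowCol, tridiagonalPowCol, ha 0, ih (by omega), hkey 0 (by omega)]
    | succ i =>
      rw [tridiagonalPowCol, tridiagonalPowCol, ha (i + 1), ih (by omega), hkey (i + 1) (by omega),
        ih (by omega)]

theorem sum_tridiagonal_mul (n : ℕ) (a b f : ℕ → ℝ) (i : Fin n) :
    ∑ j : Fin n, tridiagonal n a b i j * f j =
      a (i + 1) * f i + (if (i : ℕ) + 1 < n then b (i + 1) * f (i + 1) else 0) +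
        (if (i : ℕ) = 0 then 0 else b i * f (i - 1)) := by
  have h1 : ∀ j : Fin n, tridiagonal n a b i j * f j =
      (fun j : ℕ => (if (i : ℕ) = j then a (i + 1) * f i else 0) +
        (if (i : ℕ) + 1 = j then b (i + 1) * f (i + 1) else 0) +
        (if (i : ℕ) - 1 = j then (if (i : ℕ) = 0 then 0 else b i * f (i - 1)) else 0)) j := by
    intro j
    simp only [tridiagonal, Matrix.of_apply]
    rcases lt_trichotomy (i : ℕ) j with h | h | h
    · by_cases h' : (i : ℕ) + 1 = j
      · simp [h.ne, h', show ¬((i : ℕ) - 1 = j) by omega]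
      · simp [h.ne, h', show ¬((i : ℕ) - 1 = j) by omega, show ¬((j : ℕ) + 1 = i) by omega]
    · by_cases h0 : (i : ℕ) = 0
      · have hj : (j : ℕ) = 0 := by omega
        simp [h0, hj]
      · simp [h, show ¬((j : ℕ) - 1 = j) by omega]
    · by_cases h' : (j : ℕ) + 1 = i
      · have h2 : (i : ℕ) - 1 = j := by omega
        have h3 : (i : ℕ) ≠ 0 := by omega
        simp [h.ne', h', h2, h3, show ¬((i : ℕ) + 1 = j) by omega]
      · simp [h.ne', h', show ¬((i : ℕ) - 1 = j) by omega, show ¬((i : ℕ) + 1 = j) by omega]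
  simp only [h1]
  rw [Fin.sum_univ_eq_sum_range (fun j : ℕ => (if (i : ℕ) = j then a (i + 1) * f i else 0) +
        (if (i : ℕ) + 1 = j then b (i + 1) * f (i + 1) else 0) +
        (if (i : ℕ) - 1 = j then (if (i : ℕ) = 0 then 0 else b i * f (i - 1)) else 0)) n,
    Finset.sum_add_distrib, Finset.sum_add_distrib, Finset.sum_ite_eq, Finset.sum_ite_eq,
    Finset.sum_ite_eq, if_pos (Finset.mem_range.2 i.2),
    if_pos (Finset.mem_range.2 (show (i : ℕ) - 1 < n by omega))]
  simp only [Finset.mem_range]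

/-- Division-free form of a conjugation by the diagonal matrix of partial products of the b_j, which
moves the off-diagonal weights to b_j² above and 1 below the diagonal. At the (1,1) entry the
product is empty, so no square roots remain. -/
theorem tridiagonal_pow_apply_zero {n : ℕ} [NeZero n] (a b : ℕ → ℝ) {k : ℕ} (hk : k ≤ n)
    (i : Fin n) : (tridiagonal n a b ^ k) i 0 =
      (∏ j ∈ Finset.range i, b (j + 1)) * tridiagonalPowCol a (fun j => b j ^ 2) k i := by
  induction k generalizing i with
  | zero =>
    by_cases h : i = 0
    · simp [h, tridiagonalPowCol]
    · have : (i : ℕ) ≠ 0 := fun h' => h (Fin.ext (by simpa using h'))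
      simp [tridiagonalPowCol, this, Matrix.one_apply_ne h]
  | succ k ih =>
    rw [pow_succ', Matrix.mul_apply]
    simp only [ih (show k ≤ n by omega)]
    rw [sum_tridiagonal_mul n a b (fun i => (∏ j ∈ Finset.range i, b (j + 1)) *
      tridiagonalPowCol a (fun j => b j ^ 2) k i) i]
    have h1 : (if (i : ℕ) + 1 < n then b (i + 1) * ((∏ j ∈ Finset.range (i + 1), b (j + 1)) *
        tridiagonalPowCol a (fun j => b j ^ 2) k (i + 1)) else 0) =
        b (i + 1) * ((∏ j ∈ Finset.range (i + 1), b (j + 1)) *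
        tridiagonalPowCol a (fun j => b j ^ 2) k (i + 1)) := by
      split_ifs with h
      · rfl
      -- Last row: the column of the infinite matrix has not reached height n after k < n steps, so
      -- the truncation is invisible.
      · rw [tridiagonalPowCol_eq_zero _ _ (show k < (i : ℕ) + 1 by omega)]; simp
    rw [h1]
    obtain ⟨i, hi⟩ := i
    cases i with
    | zero => simp [tridiagonalPowCol]; ring
    | succ i =>
      simp only [Nat.add_eq_zero_iff, one_ne_zero, and_false, if_false, Nat.add_sub_cancel]
      rw [Finset.prod_range_succ _ (i + 1), Finset.prod_range_succ _ i, tridiagonalPowCol]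
      ring

theorem rescaledJacobiMatrix_eq_tridiagonal (n : ℕ) (p₁ p₂ : ℝ) (c s : ℕ → ℝ) :
    rescaledJacobiMatrix n p₁ p₂ c s =
      tridiagonal n (fun k => (√(n * p₁))⁻¹ * ((p₁ + p₂) * coeffA c s k - p₁))
        (fun k => (√(n * p₁))⁻¹ * ((p₁ + p₂) * coeffB c s k)) := by
  ext i j
  by_cases h : i = j
  · subst h
    simp [rescaledJacobiMatrix, jacobiMatrix, tridiagonal]
  · have h' : (i : ℕ) ≠ j := fun h' => h (Fin.ext h')
    simp only [rescaledJacobiMatrix, jacobiMatrix, tridiagonal, Matrix.smul_apply,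
      Matrix.sub_apply, Matrix.of_apply, Matrix.one_apply_ne h, if_neg h', smul_eq_mul]
    split_ifs <;> simp

theorem spectralPairing_eq_sum {Ω : Type*} (n : ℕ) [NeZero n] (p₁ p₂ : ℝ) (c s : ℕ → Ω → ℝ)
    (p : ℝ[X]) (ω : Ω) : spectralPairing n p₁ p₂ c s p ω =
      ∑ k ∈ Finset.range (p.natDegree + 1), p.coeff k *
        (rescaledJacobiMatrix n p₁ p₂ (fun k => c k ω) (fun k => s k ω) ^ k) 0 0 := by
  rw [spectralPairing, (isSpectralMeasure_spectralMeasure _).integral_eval,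
    Polynomial.aeval_eq_sum_range, Matrix.sum_apply]
  simp [Matrix.smul_apply]

/-- If `d` agrees with the squared off-diagonal coefficients, the spectral pairing is a polynomial
expression in the coefficients as soon as the matrix is large enough. -/
theorem spectralPairing_eq_sum_tridiagonalPowCol {Ω : Type*} (n : ℕ) [NeZero n] (p₁ p₂ : ℝ)
    (c s : ℕ → Ω → ℝ) (p : ℝ[X]) (ω : Ω) (hn : p.natDegree ≤ n) (a d : ℕ → ℝ)
    (ha : ∀ i, (√(n * p₁))⁻¹ *
      ((p₁ + p₂) * coeffA (fun k => c k ω) (fun k => s k ω) (i + 1) - p₁) = a (i + 1))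
    (hd : ∀ i, i + 1 < n → ((√(n * p₁))⁻¹ *
      ((p₁ + p₂) * coeffB (fun k => c k ω) (fun k => s k ω) (i + 1))) ^ 2 = d (i + 1)) :
    spectralPairing n p₁ p₂ c s p ω =
      ∑ k ∈ Finset.range (p.natDegree + 1), p.coeff k * tridiagonalPowCol a d k 0 := by
  rw [spectralPairing_eq_sum]
  refine Finset.sum_congr rfl fun k hk => ?_
  have hk' : k ≤ n := by have := Finset.mem_range.1 hk; omega
  rw [rescaledJacobiMatrix_eq_tridiagonal, tridiagonal_pow_apply_zero _ _ hk']
  simp only [Fin.val_zero, Finset.range_zero, Finset.prod_empty, one_mul]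
  rw [tridiagonalPowCol_congr ha hd (by omega)]

end TridiagonalPowers

/-! ### Jets of tridiagonal recursions and finite sums. -/

section Jets

variable {ι : Type*} {Ω : ι → Type*} [∀ i, MeasurableSpace (Ω i)] {P : ∀ i, Measure (Ω i)}
  {l : Filter ι} [∀ i, IsProbabilityMeasure (P i)] {κ : Type*} {t : ι → ℝ}
  {Z : κ → ∀ i, Ω i → ℝ}

/-- Jets respect sums and products, so the recursion over random variables is shadowed by the same
recursion over dual numbers. -/
theorem HasJet.tridiagonalPowCol (hZ : ∀ a, MomentBounded P l (Z a)) (ht : Tendsto t l atTop)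
    {a d : ℕ → ∀ i, Ω i → ℝ} {qa qd : ℕ → TrivSqZeroExt ℝ (κ →₀ ℝ)}
    (ha : ∀ j, HasJet P l t Z (a (j + 1)) (qa (j + 1)))
    (hd : ∀ j, HasJet P l t Z (d (j + 1)) (qd (j + 1))) (k j : ℕ) :
    HasJet P l t Z (_root_.tridiagonalPowCol a d k j) (_root_.tridiagonalPowCol qa qd k j) := by
  induction k generalizing j with
  | zero =>
    simp only [_root_.tridiagonalPowCol]
    split_ifs
    · exact hasJet_const (m := fun _ => 1) tendsto_const_nhds
    · exact hasJet_const (m := fun _ => 0) tendsto_const_nhds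
  | succ k ih =>
    cases j with
    | zero => exact ((ha 0).mul hZ ht (ih 0)).add ((hd 0).mul hZ ht (ih 1))
    | succ j =>
      exact (((ha (j + 1)).mul hZ ht (ih (j + 1))).add ((hd (j + 1)).mul hZ ht (ih (j + 2)))).add
        (ih j)

theorem HasJet.sum {α : Type*} (s : Finset α)
    {Y : α → ∀ i, Ω i → ℝ} {q : α → TrivSqZeroExt ℝ (κ →₀ ℝ)}
    (h : ∀ j ∈ s, HasJet P l t Z (Y j) (q j)) :
    HasJet P l t Z (∑ j ∈ s, Y j) (∑ j ∈ s, q j) := by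
  classical
  induction s using Finset.induction_on with
  | empty => exact hasJet_const (m := fun _ => 0) tendsto_const_nhds
  | insert j s hj ih =>
    rw [Finset.sum_insert hj, Finset.sum_insert hj]
    exact (h j (Finset.mem_insert_self _ _)).add
      (ih fun k hk => h k (Finset.mem_insert_of_mem hk))

end Jets

/-! ### Arrays of beta variables with diverging first shape parameter. -/

section BetaArrays

variable {ι : Type*} {Ω : ι → Type*} [∀ i, MeasurableSpace (Ω i)] {P : ∀ i, Measure (Ω i)}
  {l : Filter ι} {X : ∀ i, Ω i → ℝ} {a b τ : ι → ℝ}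

theorem integral_beta_centered_eq_zero {α : Type*} [MeasurableSpace α] {μ : Measure α} {X : α → ℝ}
    {a b : ℝ} (ha : 0 < a) (hb : 0 < b) (hX : HasLaw X (betaMeasure a b) μ) (τ : ℝ) :
    ∫ ω, τ * (X ω - a / (a + b)) ∂μ = 0 := by
  have := isProbabilityMeasureBeta ha hb
  have h := hX.integral_comp (f := fun x => τ * (x - a / (a + b)))
    (Continuous.aestronglyMeasurable (by fun_prop))
  simp only [Function.comp_def] at h
  rw [h, integral_const_mul, integral_sub (integrable_betaMeasure_of_continuous ha hb (by fun_prop))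
    (integrable_const _), integral_betaMeasure_id ha hb]
  simp

theorem momentBounded_beta [∀ i, IsProbabilityMeasure (P i)]
    (hX : ∀ᶠ i in l, HasLaw (X i) (betaMeasure (a i) (b i)) (P i))
    (ha : Tendsto a l atTop) (hb : ∀ᶠ i in l, 0 < b i)
    (hτ : Tendsto (fun i => τ i ^ 2 * a i / (a i + b i) ^ 2) l (𝓝 1)) :
    MomentBounded P l (fun i ω => τ i * (X i ω - a i / (a i + b i))) := by
  constructor
  · filter_upwards [hX] with i hi
    exact ((hi.aemeasurable.sub_const _).const_mul _).aestronglyMeasurable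
  · intro k hk
    obtain ⟨C, hC0, hC⟩ := exists_integral_sub_pow_betaMeasure_le k
    -- The normalised proxy τ²a/(a + b)² tends to 1, hence is eventually at most 2; the 2k-th moment
    -- is then at most C·2^k.
    refine ⟨Real.toNNReal ((C * 2 ^ k) ^ ((2 * k : ℕ) : ℝ)⁻¹), ?_⟩
    filter_upwards [hX, ha.eventually_ge_atTop 1, hb, hτ.eventually (ge_mem_nhds one_lt_two)]
      with i hX ha hb hτ
    have ha0 : 0 < a i := zero_lt_one.trans_le ha
    have hm : AEStronglyMeasurable (fun ω => τ i * (X i ω - a i / (a i + b i))) (P i) :=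
      ((hX.aemeasurable.sub_const _).const_mul _).aestronglyMeasurable
    refine (eLpNorm_le_eLpNorm_of_exponent_le (q := ((2 * k : ℕ) : ℝ≥0∞))
      (by exact_mod_cast (by omega : k ≤ 2 * k)) hm).trans ?_
    have hmap : eLpNorm (fun ω => τ i * (X i ω - a i / (a i + b i))) ((2 * k : ℕ) : ℝ≥0∞) (P i) =
        eLpNorm (fun x => τ i * (x - a i / (a i + b i))) ((2 * k : ℕ) : ℝ≥0∞)
          (betaMeasure (a i) (b i)) := by
      rw [← hX.map_eq, eLpNorm_map_measure (Continuous.aestronglyMeasurable (by fun_prop))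
        hX.aemeasurable]
      rfl
    have := isProbabilityMeasureBeta ha0 hb
    have hmem : MemLp (fun x => τ i * (x - a i / (a i + b i))) ((2 * k : ℕ) : ℝ≥0∞)
        (betaMeasure (a i) (b i)) := by
      obtain ⟨B, hB⟩ := (isCompact_Icc (a := (0 : ℝ)) (b := 1)).exists_bound_of_continuousOn
        (f := fun x => τ i * (x - a i / (a i + b i))) (Continuous.continuousOn (by fun_prop))
      refine MemLp.of_bound (Continuous.aestronglyMeasurable (by fun_prop)) B ?_
      filter_upwards [ae_mem_Ioo_betaMeasure (a i) (b i)] with x hx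
      exact hB x (Set.Ioo_subset_Icc_self hx)
    rw [hmap, hmem.eLpNorm_eq_integral_rpow_norm (by exact_mod_cast (by omega : 2 * k ≠ 0))
      (ENNReal.natCast_ne_top _)]
    change ENNReal.ofReal _ ≤ ENNReal.ofReal _
    refine ENNReal.ofReal_le_ofReal ?_
    simp only [ENNReal.toReal_natCast, Real.rpow_natCast]
    refine Real.rpow_le_rpow (integral_nonneg fun x => by positivity) ?_ (by positivity)
    have h1 : ∀ x : ℝ, ‖τ i * (x - a i / (a i + b i))‖ ^ (2 * k) =
        τ i ^ (2 * k) * (x - a i / (a i + b i)) ^ (2 * k) := fun x => by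
      rw [← mul_pow, Real.norm_eq_abs, pow_mul, sq_abs, ← pow_mul]
    simp only [h1]
    rw [integral_const_mul]
    calc _ ≤ τ i ^ (2 * k) * (C * (a i / (a i + b i) ^ 2) ^ k) := by
          refine mul_le_mul_of_nonneg_left (hC _ _ ha hb) ?_
          rw [pow_mul]; positivity
      _ = C * (τ i ^ 2 * a i / (a i + b i) ^ 2) ^ k := by rw [pow_mul, mul_div_assoc, mul_pow]; ring
      _ ≤ C * 2 ^ k := by gcongr

theorem tendsto_charFun_beta {v : ℝ}
    (hX : ∀ᶠ i in l, HasLaw (X i) (betaMeasure (a i) (b i)) (P i))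
    (ha : Tendsto a l atTop) (hb : ∀ᶠ i in l, 0 < b i)
    (hτ : Tendsto (fun i => τ i ^ 2 * a i / (a i + b i) ^ 2) l (𝓝 1))
    (hv : Tendsto (fun i => b i / (a i + b i)) l (𝓝 v)) (u : ℝ) :
    Tendsto (fun i => charFun ((P i).map fun ω => τ i * (X i ω - a i / (a i + b i))) u) l
      (𝓝 (Complex.exp (-(v * (u : ℂ) ^ 2 / 2)))) := by
  obtain ⟨C, hC0, hC⟩ := exists_norm_integral_cexp_betaMeasure_sub_le
  have h1 : Tendsto (fun i => Complex.exp (-((τ i ^ 2 * a i / (a i + b i) ^ 2 *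
      (b i / (a i + b i)) : ℝ) * (u : ℂ) ^ 2 / 2))) l
      (𝓝 (Complex.exp (-(v * (u : ℂ) ^ 2 / 2)))) := by
    have h2 := hτ.mul hv
    rw [one_mul] at h2
    have hc : Continuous fun w : ℝ => Complex.exp (-((w : ℂ) * (u : ℂ) ^ 2 / 2)) := by fun_prop
    exact (hc.tendsto v).comp h2
  have h3 : Tendsto (fun i => C * u ^ 2 * (τ i ^ 2 * a i / (a i + b i) ^ 2) / √(a i)) l (𝓝 0) :=
    (hτ.const_mul _).div_atTop (Real.tendsto_sqrt_atTop.comp ha)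
  have h4 : Tendsto (fun i => charFun ((P i).map fun ω => τ i * (X i ω - a i / (a i + b i))) u -
      Complex.exp (-((τ i ^ 2 * a i / (a i + b i) ^ 2 *
      (b i / (a i + b i)) : ℝ) * (u : ℂ) ^ 2 / 2))) l (𝓝 0) := by
    refine squeeze_zero_norm' ?_ h3
    filter_upwards [hX, ha.eventually_ge_atTop 1, hb] with i hX ha hb
    refine le_trans (le_of_eq ?_) (hC (a i) (b i) (τ i) u ha hb)
    have hmap : (P i).map (fun ω => τ i * (X i ω - a i / (a i + b i))) =
        (betaMeasure (a i) (b i)).map (fun x => τ i * (x - a i / (a i + b i))) := by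
      rw [← hX.map_eq, AEMeasurable.map_map_of_aemeasurable (Measurable.aemeasurable (by fun_prop))
        hX.aemeasurable]
      rfl
    rw [hmap, charFun_apply_real, integral_map (Measurable.aemeasurable (by fun_prop))
      (Continuous.aestronglyMeasurable (by fun_prop))]
    push_cast
    rfl
  simpa using h4.add h1

end BetaArrays

/-! ### Asymptotics of the shape parameters, scales and centres. -/

section Asymptotics

theorem tendsto_add_const_div_self {ι : Type*} {l : Filter ι} {x : ι → ℝ} (hx : Tendsto x l atTop)
    (C : ℝ) : Tendsto (fun i => (x i + C) / x i) l (𝓝 1) := by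
  have h : Tendsto (fun i => 1 + C / x i) l (𝓝 (1 + 0)) :=
    tendsto_const_nhds.add (tendsto_const_nhds.div_atTop hx)
  rw [add_zero] at h
  refine h.congr' ?_
  filter_upwards [hx.eventually_gt_atTop 0] with i hi
  field_simp

theorem tendsto_div_add_const {ι : Type*} {l : Filter ι} {x : ι → ℝ} (hx : Tendsto x l atTop)
    (C : ℝ) : Tendsto (fun i => x i / (x i + C)) l (𝓝 1) := by
  have h := (tendsto_add_const_div_self hx C).inv₀ one_ne_zero
  simpa using h

theorem tendsto_pnat_cast_atTop : Tendsto (fun n : ℕ+ => (n : ℝ)) atTop atTop :=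
  tendsto_natCast_atTop_atTop.comp tendsto_PNat_val_atTop_atTop

theorem eventually_lt_pnat_cast (C : ℝ) : ∀ᶠ n : ℕ+ in atTop, C < n :=
  tendsto_pnat_cast_atTop.eventually_gt_atTop C

namespace AssumptionH

variable {β p₁ p₂ : ℕ+ → ℝ} {γ σ : ℝ} (H : AssumptionH β p₁ p₂ γ σ)
include H

theorem p₁_pos (n : ℕ+) : 0 < p₁ n := lt_of_lt_of_le (by exact_mod_cast n.pos) (H.le_p₁ n)

theorem p₂_pos (n : ℕ+) : 0 < p₂ n := lt_of_lt_of_le (by exact_mod_cast n.pos) (H.le_p₂ n)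

theorem tendsto_p₁ : Tendsto p₁ atTop atTop := tendsto_atTop_mono H.le_p₁ tendsto_pnat_cast_atTop

theorem tendsto_p₂ : Tendsto p₂ atTop atTop := tendsto_atTop_mono H.le_p₂ tendsto_pnat_cast_atTop

theorem tendsto_add : Tendsto (fun n => p₁ n + p₂ n) atTop atTop :=
  H.tendsto_p₁.atTop_add_atTop H.tendsto_p₂

theorem one_add_sigma_pos : 0 < 1 + σ := by linarith [H.sigma_nonneg]

theorem tendsto_p₂_div_add : Tendsto (fun n => p₂ n / (p₁ n + p₂ n)) atTop (𝓝 (1 / (1 + σ))) := by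
  have h := (H.tendsto_sigma.const_add 1).inv₀ H.one_add_sigma_pos.ne'
  rw [← one_div] at h
  refine h.congr fun n => ?_
  have := H.p₁_pos n
  have := H.p₂_pos n
  field_simp
  ring

theorem tendsto_p₁_div_add : Tendsto (fun n => p₁ n / (p₁ n + p₂ n)) atTop (𝓝 (σ / (1 + σ))) := by
  have h := H.tendsto_sigma.mul H.tendsto_p₂_div_add
  rw [mul_one_div] at h
  refine h.congr fun n => ?_
  have := H.p₁_pos n
  have := H.p₂_pos n
  field_simp

theorem tendsto_div_add : Tendsto (fun n : ℕ+ => (n : ℝ) / (p₁ n + p₂ n)) atTop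
    (𝓝 (γ * (σ / (1 + σ)))) := by
  refine (H.tendsto_gamma.mul H.tendsto_p₁_div_add).congr fun n => ?_
  have := H.p₁_pos n
  have := H.p₂_pos n
  field_simp

theorem tendsto_sqrt_beta_mul : Tendsto (fun n : ℕ+ => √(β n / 2 * (n : ℝ))) atTop atTop := by
  refine Real.tendsto_sqrt_atTop.comp ?_
  refine (H.tendsto_beta.atTop_div_const (zero_lt_two (α := ℝ))).congr fun n => ?_
  ring

theorem tendsto_sqrt_div_div : Tendsto (fun n : ℕ+ => √(p₁ n / n) / p₁ n) atTop (𝓝 0) := by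
  refine squeeze_zero (fun n => div_nonneg (Real.sqrt_nonneg _) (H.p₁_pos n).le) (fun n => ?_)
    tendsto_pnat_cast_atTop.inv_tendsto_atTop
  have hn : 0 < (n : ℝ) := by exact_mod_cast n.pos
  have h1 : 1 ≤ p₁ n / n := (one_le_div hn).2 (H.le_p₁ n)
  have h2 : √(p₁ n / n) ≤ p₁ n / n := Real.sqrt_le_iff.2 ⟨by positivity, by nlinarith⟩
  have h3 := H.p₁_pos n
  calc √(p₁ n / n) / p₁ n ≤ (p₁ n / n) / p₁ n := by gcongr
    _ = _ := by simp only [Pi.inv_apply]; field_simp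

end AssumptionH

/-- First shape parameter of the `k + 1`-st variable; `Sum.inl` stands for the variables `c`
and `Sum.inr` for the variables `s`. -/
noncomputable def shapeA (β p₁ : ℕ+ → ℝ) : ℕ ⊕ ℕ → ℕ+ → ℝ
  | .inl k, n => β n / 2 * (p₁ n - k)
  | .inr k, n => β n / 2 * (n - k - 1)

/-- Second shape parameter of the `k + 1`-st variable. -/
noncomputable def shapeB (β p₁ p₂ : ℕ+ → ℝ) : ℕ ⊕ ℕ → ℕ+ → ℝ
  | .inl k, n => β n / 2 * (p₂ n - k)
  | .inr k, n => β n / 2 * (p₁ n + p₂ n - n - k)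

/-- The factor by which the fluctuations of the `k + 1`-st variable are rescaled. -/
noncomputable def fluctScale (β p₁ p₂ : ℕ+ → ℝ) : ℕ ⊕ ℕ → ℕ+ → ℝ
  | .inl _, n => √(β n / 2 * n) * √(p₁ n / n) * ((p₁ n + p₂ n) / p₁ n)
  | .inr _, n => √(β n / 2 * n) * ((p₁ n + p₂ n) / n)

/-- The `k + 1`-st variable. -/
def jacobiCoord {Ω : ℕ+ → Type*} (c s : ∀ n, ℕ → Ω n → ℝ) : ℕ ⊕ ℕ → ∀ n, Ω n → ℝ
  | .inl k, n => c n (k + 1)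
  | .inr k, n => s n (k + 1)

/-- The limiting variance of the rescaled fluctuations of the `k + 1`-st variable. -/
noncomputable def limitVar (γ σ : ℝ) : ℕ ⊕ ℕ → ℝ
  | .inl _ => 1 / (1 + σ)
  | .inr _ => 1 - γ * (σ / (1 + σ))

/-- The centred and rescaled variables. -/
noncomputable def fluct {Ω : ℕ+ → Type*} (β p₁ p₂ : ℕ+ → ℝ) (c s : ∀ n, ℕ → Ω n → ℝ) (a : ℕ ⊕ ℕ) (n : ℕ+)
    (ω : Ω n) : ℝ :=
  fluctScale β p₁ p₂ a n *
    (jacobiCoord c s a n ω - shapeA β p₁ a n / (shapeA β p₁ a n + shapeB β p₁ p₂ a n))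

theorem shapeA_add_shapeB_inl (β p₁ p₂ : ℕ+ → ℝ) (k : ℕ) (n : ℕ+) :
    shapeA β p₁ (.inl k) n + shapeB β p₁ p₂ (.inl k) n =
      β n / 2 * (p₁ n + p₂ n + -(2 * k)) := by
  simp only [shapeA, shapeB]; ring

theorem shapeA_add_shapeB_inr (β p₁ p₂ : ℕ+ → ℝ) (k : ℕ) (n : ℕ+) :
    shapeA β p₁ (.inr k) n + shapeB β p₁ p₂ (.inr k) n =
      β n / 2 * (p₁ n + p₂ n + -(2 * k + 1)) := by
  simp only [shapeA, shapeB]; ring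

namespace AssumptionH

variable {β p₁ p₂ : ℕ+ → ℝ} {γ σ : ℝ} (H : AssumptionH β p₁ p₂ γ σ)
include H

theorem limitVar_nonneg (a : ℕ ⊕ ℕ) : 0 ≤ limitVar γ σ a := by
  have h := H.one_add_sigma_pos
  cases a with
  | inl k => simp only [limitVar]; positivity
  | inr k =>
    have : γ * (σ / (1 + σ)) = σ * γ / (1 + σ) := by ring
    simp only [limitVar, this, sub_nonneg, div_le_one h]
    linarith [H.sigma_mul_gamma_lt, H.sigma_nonneg]

theorem shapeB_pos (a : ℕ ⊕ ℕ) : ∀ᶠ n in atTop, 0 < shapeB β p₁ p₂ a n := by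
  cases a with
  | inl k =>
    filter_upwards [eventually_lt_pnat_cast k] with n hn
    exact mul_pos (half_pos (H.beta_pos n)) (by linarith [H.le_p₂ n])
  | inr k =>
    filter_upwards [eventually_lt_pnat_cast k] with n hn
    exact mul_pos (half_pos (H.beta_pos n)) (by linarith [H.le_p₁ n, H.le_p₂ n])

theorem tendsto_shapeA (a : ℕ ⊕ ℕ) : Tendsto (shapeA β p₁ a) atTop atTop := by
  -- Once n > 2(k + 1), both p₁ - k and n - k - 1 are at least n/2, so either first shape parameter
  -- is at least βn/4. This is where βn → ∞ makes the variables concentrate.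
  have h := H.tendsto_beta.atTop_div_const (zero_lt_four (α := ℝ))
  cases a with
  | inl k =>
    refine tendsto_atTop_mono' _ ?_ h
    filter_upwards [eventually_lt_pnat_cast (2 * (k + 1))] with n hn
    have h2 : (n : ℝ) / 2 ≤ p₁ n - k := by linarith [H.le_p₁ n]
    simp only [shapeA]
    nlinarith [mul_le_mul_of_nonneg_left h2 (half_pos (H.beta_pos n)).le]
  | inr k =>
    refine tendsto_atTop_mono' _ ?_ h
    filter_upwards [eventually_lt_pnat_cast (2 * (k + 1))] with n hn
    have h2 : (n : ℝ) / 2 ≤ n - k - 1 := by linarith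
    simp only [shapeA]
    nlinarith [mul_le_mul_of_nonneg_left h2 (half_pos (H.beta_pos n)).le]

/-- The variance of a beta variable is close to a/(a + b)² · b/(a + b). The scale normalises the
first factor; the second has limit `limitVar`. -/
theorem tendsto_fluctScale (a : ℕ ⊕ ℕ) :
    Tendsto (fun n => fluctScale β p₁ p₂ a n ^ 2 * shapeA β p₁ a n /
      (shapeA β p₁ a n + shapeB β p₁ p₂ a n) ^ 2) atTop (𝓝 1) := by
  cases a with
  | inl k =>
    have h := (tendsto_add_const_div_self H.tendsto_p₁ (-k)).mul
      ((tendsto_div_add_const H.tendsto_add (-(2 * k))).pow 2)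
    rw [one_pow, one_mul] at h
    refine h.congr' ?_
    filter_upwards [eventually_lt_pnat_cast k] with n hn
    have hβ := H.beta_pos n
    have hn0 : 0 < (n : ℝ) := by exact_mod_cast n.pos
    have h1 := H.p₁_pos n
    have h2 : 0 < p₁ n + p₂ n + -(2 * k) := by linarith [H.le_p₁ n, H.le_p₂ n]
    rw [shapeA_add_shapeB_inl]
    simp only [fluctScale, shapeA]
    rw [mul_pow, mul_pow, Real.sq_sqrt (by positivity), Real.sq_sqrt (by positivity)]
    field_simp
    ring
  | inr k =>
    have h := (tendsto_add_const_div_self tendsto_pnat_cast_atTop (-(k + 1))).mul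
      ((tendsto_div_add_const H.tendsto_add (-(2 * k + 1))).pow 2)
    rw [one_pow, one_mul] at h
    refine h.congr' ?_
    filter_upwards [eventually_lt_pnat_cast (k + 1)] with n hn
    have hβ := H.beta_pos n
    have hn0 : 0 < (n : ℝ) := by exact_mod_cast n.pos
    have h2 : 0 < p₁ n + p₂ n + -(2 * k + 1) := by linarith [H.le_p₁ n, H.le_p₂ n]
    rw [shapeA_add_shapeB_inr]
    simp only [fluctScale, shapeA]
    rw [mul_pow, Real.sq_sqrt (by positivity)]
    field_simp
    ring

theorem tendsto_shapeB_div (a : ℕ ⊕ ℕ) :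
    Tendsto (fun n => shapeB β p₁ p₂ a n / (shapeA β p₁ a n + shapeB β p₁ p₂ a n)) atTop
      (𝓝 (limitVar γ σ a)) := by
  cases a with
  | inl k =>
    have h := ((tendsto_add_const_div_self H.tendsto_p₂ (-k)).mul H.tendsto_p₂_div_add).mul
      (tendsto_div_add_const H.tendsto_add (-(2 * k)))
    rw [mul_one, one_mul] at h
    refine h.congr' ?_
    filter_upwards [eventually_lt_pnat_cast k] with n hn
    have hβ := H.beta_pos n
    have h1 := H.p₁_pos n
    have h1' := H.p₂_pos n
    have h2 : 0 < p₁ n + p₂ n + -(2 * k) := by linarith [H.le_p₁ n, H.le_p₂ n]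
    rw [shapeA_add_shapeB_inl]
    simp only [shapeB]
    field_simp
    ring
  | inr k =>
    have h := (((tendsto_add_const_div_self tendsto_pnat_cast_atTop (-(k + 1))).mul
      H.tendsto_div_add).mul (tendsto_div_add_const H.tendsto_add (-(2 * k + 1)))).const_sub 1
    rw [mul_one, one_mul] at h
    refine h.congr' ?_
    filter_upwards [eventually_lt_pnat_cast (k + 1)] with n hn
    have hβ := H.beta_pos n
    have hn0 : 0 < (n : ℝ) := by exact_mod_cast n.pos
    have h1 := H.p₁_pos n
    have h1' := H.p₂_pos n
    have h2 : 0 < p₁ n + p₂ n + -(2 * k + 1) := by linarith [H.le_p₁ n, H.le_p₂ n]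
    rw [shapeA_add_shapeB_inr]
    simp only [shapeB]
    obtain ⟨N, hN⟩ : ∃ N, N = p₁ n + p₂ n + -(2 * k + 1) := ⟨_, rfl⟩
    rw [← hN] at h2 ⊢
    field_simp
    rw [hN]
    ring

/-- The relative bias of the mean is exactly (k/p₁)(2p₁/(p₁+p₂) - 1) · (p₁+p₂)/(p₁+p₂-2k). It
survives the possibly unbounded factor √(p₁/n) because √(p₁/n)/p₁ ≤ 1/n. -/
theorem tendsto_center_inl (k : ℕ) :
    Tendsto (fun n : ℕ+ => √(p₁ n / n) * ((p₁ n + p₂ n) / p₁ n * (shapeA β p₁ (.inl k) n /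
      (shapeA β p₁ (.inl k) n + shapeB β p₁ p₂ (.inl k) n)) - 1)) atTop (𝓝 0) := by
  have h := ((H.tendsto_sqrt_div_div.const_mul (k : ℝ)).mul
    ((H.tendsto_p₁_div_add.const_mul 2).sub_const 1)).mul
    (tendsto_div_add_const H.tendsto_add (-(2 * k)))
  rw [mul_zero, zero_mul, zero_mul] at h
  refine h.congr' ?_
  filter_upwards [eventually_lt_pnat_cast k] with n hn
  have hβ := H.beta_pos n
  have h1 := H.p₁_pos n
  have h1' := H.p₂_pos n
  have h2 : 0 < p₁ n + p₂ n + -(2 * k) := by linarith [H.le_p₁ n, H.le_p₂ n]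
  rw [shapeA_add_shapeB_inl]
  simp only [shapeA]
  obtain ⟨N, hN⟩ : ∃ N, N = p₁ n + p₂ n + -(2 * k) := ⟨_, rfl⟩
  rw [← hN] at h2 ⊢
  field_simp
  rw [hN]
  ring

theorem tendsto_center_inr (k : ℕ) :
    Tendsto (fun n : ℕ+ => (p₁ n + p₂ n) / n * (shapeA β p₁ (.inr k) n /
      (shapeA β p₁ (.inr k) n + shapeB β p₁ p₂ (.inr k) n))) atTop (𝓝 1) := by
  have h := (tendsto_add_const_div_self tendsto_pnat_cast_atTop (-(k + 1))).mul
    (tendsto_div_add_const H.tendsto_add (-(2 * k + 1)))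
  rw [one_mul] at h
  refine h.congr' ?_
  filter_upwards [eventually_lt_pnat_cast (k + 1)] with n hn
  have hβ := H.beta_pos n
  have hn0 : 0 < (n : ℝ) := by exact_mod_cast n.pos
  have h2 : 0 < p₁ n + p₂ n + -(2 * k + 1) := by linarith [H.le_p₁ n, H.le_p₂ n]
  rw [shapeA_add_shapeB_inr]
  simp only [shapeA]
  field_simp
  ring

end AssumptionH

end Asymptotics

/-! ### Jets of the matrix coefficients and of the spectral pairing. -/

section JacobiJets

/-- Jet of `√(p₁ / n) * ((p₁ + p₂) / p₁ * c (k + 1) - 1)`. -/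
noncomputable def jetD (k : ℕ) : TrivSqZeroExt ℝ (ℕ ⊕ ℕ →₀ ℝ) :=
  .inl 0 + .inr (Finsupp.single (.inl k) 1)

/-- Jet of `(p₁ + p₂) / n * s k`. -/
noncomputable def jetS : ℕ → TrivSqZeroExt ℝ (ℕ ⊕ ℕ →₀ ℝ)
  | 0 => .inl 0
  | k + 1 => .inl 1 + .inr (Finsupp.single (.inr k) 1)

/-- Jet of `(p₁ + p₂) / p₁ * c (k + 1)`. -/
noncomputable def jetE (γ : ℝ) (k : ℕ) : TrivSqZeroExt ℝ (ℕ ⊕ ℕ →₀ ℝ) :=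
  .inl 1 + .inl √γ * jetD k

/-- Jet of `c k`. -/
noncomputable def jetC (γ σ : ℝ) : ℕ → TrivSqZeroExt ℝ (ℕ ⊕ ℕ →₀ ℝ)
  | 0 => .inl 0
  | k + 1 => .inl (σ / (1 + σ)) * jetE γ k

/-- Jet of the `k`-th diagonal coefficient of the rescaled matrix. -/
noncomputable def jetDiag (γ σ : ℝ) (k : ℕ) : TrivSqZeroExt ℝ (ℕ ⊕ ℕ →₀ ℝ) :=
  jetD (k - 1) + .inl √γ * jetS (k - 1) * (.inl 1 - jetC γ σ (k - 1) - jetC γ σ k)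

/-- Jet of the squared `k`-th off-diagonal coefficient of the rescaled matrix. -/
noncomputable def jetOffDiagSq (γ σ : ℝ) (k : ℕ) : TrivSqZeroExt ℝ (ℕ ⊕ ℕ →₀ ℝ) :=
  jetE γ (k - 1) * (.inl 1 - jetC γ σ k) * jetS k *
    (.inl 1 - .inl (γ * (σ / (1 + σ))) * jetS (k - 1))

/-- Jet of the spectral pairing with the polynomial `p`. -/
noncomputable def jetPairing (γ σ : ℝ) (p : ℝ[X]) : TrivSqZeroExt ℝ (ℕ ⊕ ℕ →₀ ℝ) :=
  ∑ k ∈ Finset.range (p.natDegree + 1),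
    .inl (p.coeff k) * tridiagonalPowCol (jetDiag γ σ) (jetOffDiagSq γ σ) k 0

/-- The limiting variance `∑ c a ^ 2 * limitVar a`, where `c` is the linear part of the jet. -/
noncomputable def pairingVar (γ σ : ℝ) (p : ℝ[X]) : ℝ :=
  ∑ a ∈ (jetPairing γ σ p).snd.support, limitVar γ σ a * (jetPairing γ σ p).snd a ^ 2

variable {Ω : ℕ+ → Type*} [∀ n, MeasurableSpace (Ω n)] {P : ∀ n, Measure (Ω n)}
  {β p₁ p₂ : ℕ+ → ℝ} {γ σ : ℝ} {c s : ∀ n, ℕ → Ω n → ℝ}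

theorem eventually_hasLaw_jacobiCoord
    (hJ : ∀ n : ℕ+, IsJacobiCoefficients (P n) n (β n) (p₁ n) (p₂ n) (c n) (s n)) (a : ℕ ⊕ ℕ) :
    ∀ᶠ n in atTop, HasLaw (jacobiCoord c s a n)
      (betaMeasure (shapeA β p₁ a n) (shapeB β p₁ p₂ a n)) (P n) := by
  cases a with
  | inl k =>
    filter_upwards [eventually_lt_pnat_cast k] with n hn
    have hk : k < (n : ℕ) := by exact_mod_cast hn
    have h := (hJ n).law_c (k + 1) (Finset.mem_Icc.2 ⟨by omega, by omega⟩)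
    have e1 : shapeA β p₁ (.inl k) n = β n / 2 * (p₁ n - (k + 1 : ℕ) + 1) := by
      simp only [shapeA]; push_cast; ring
    have e2 : shapeB β p₁ p₂ (.inl k) n = β n / 2 * (p₂ n - (k + 1 : ℕ) + 1) := by
      simp only [shapeB]; push_cast; ring
    rw [e1, e2]
    exact h
  | inr k =>
    filter_upwards [eventually_lt_pnat_cast (k + 1)] with n hn
    have hk : k + 1 < (n : ℕ) := by exact_mod_cast hn
    have h := (hJ n).law_s (k + 1) (Finset.mem_Icc.2 ⟨by omega, by omega⟩)
    have e1 : shapeA β p₁ (.inr k) n = β n / 2 * (n - (k + 1 : ℕ)) := by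
      simp only [shapeA]; push_cast; ring
    have e2 : shapeB β p₁ p₂ (.inr k) n =
        β n / 2 * (p₁ n + p₂ n - n - (k + 1 : ℕ) + 1) := by
      simp only [shapeB]; push_cast; ring
    rw [e1, e2]
    exact h

variable [∀ n, IsProbabilityMeasure (P n)]

theorem momentBounded_fluct (H : AssumptionH β p₁ p₂ γ σ)
    (hJ : ∀ n : ℕ+, IsJacobiCoefficients (P n) n (β n) (p₁ n) (p₂ n) (c n) (s n)) (a : ℕ ⊕ ℕ) :
    MomentBounded P atTop (fluct β p₁ p₂ c s a) :=
  momentBounded_beta (eventually_hasLaw_jacobiCoord hJ a) (H.tendsto_shapeA a) (H.shapeB_pos a)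
    (H.tendsto_fluctScale a)

theorem hasJet_jetD (H : AssumptionH β p₁ p₂ γ σ) (k : ℕ) :
    HasJet P atTop (fun n : ℕ+ => √(β n / 2 * n)) (fluct β p₁ p₂ c s)
      (fun n ω => √(p₁ n / n) * ((p₁ n + p₂ n) / p₁ n * c n (k + 1) ω - 1)) (jetD k) := by
  refine hasJet_of_affine (H.tendsto_center_inl k) (Eventually.of_forall fun n =>
    Eventually.of_forall fun ω => ?_)
  simp only [fluct, fluctScale, jacobiCoord]
  ring

theorem hasJet_jetS (H : AssumptionH β p₁ p₂ γ σ)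
    (hJ : ∀ n : ℕ+, IsJacobiCoefficients (P n) n (β n) (p₁ n) (p₂ n) (c n) (s n)) (k : ℕ) :
    HasJet P atTop (fun n : ℕ+ => √(β n / 2 * n)) (fluct β p₁ p₂ c s)
      (fun n ω => (p₁ n + p₂ n) / n * s n k ω) (jetS k) := by
  cases k with
  | zero =>
    refine (hasJet_const (m := fun _ => 0) tendsto_const_nhds).congr (Eventually.of_forall fun n =>
      Eventually.of_forall fun ω => ?_)
    simp [(hJ n).s_zero]
  | succ k =>
    refine hasJet_of_affine (H.tendsto_center_inr k) (Eventually.of_forall fun n =>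
      Eventually.of_forall fun ω => ?_)
    simp only [fluct, fluctScale, jacobiCoord]
    ring

theorem sqrt_div_mul_sqrt_div {x y : ℝ} (hx : 0 < x) (hy : 0 < y) : √(x / y) * √(y / x) = 1 := by
  rw [← Real.sqrt_mul (by positivity)]
  have : x / y * (y / x) = 1 := by field_simp
  rw [this, Real.sqrt_one]

theorem hasJet_jetE (H : AssumptionH β p₁ p₂ γ σ)
    (hJ : ∀ n : ℕ+, IsJacobiCoefficients (P n) n (β n) (p₁ n) (p₂ n) (c n) (s n)) (k : ℕ) :
    HasJet P atTop (fun n : ℕ+ => √(β n / 2 * n)) (fluct β p₁ p₂ c s)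
      (fun n ω => (p₁ n + p₂ n) / p₁ n * c n (k + 1) ω) (jetE γ k) := by
  have hZ := momentBounded_fluct H hJ
  refine ((hasJet_const (m := fun _ => 1) tendsto_const_nhds).add ((hasJet_const
    (m := fun n : ℕ+ => √(n / p₁ n)) H.tendsto_gamma.sqrt).mul hZ H.tendsto_sqrt_beta_mul
    (hasJet_jetD H k))).congr (Eventually.of_forall fun n => Eventually.of_forall fun ω => ?_)
  have hn0 : 0 < (n : ℝ) := by exact_mod_cast n.pos
  simp only [Pi.add_apply, Pi.mul_apply]
  rw [← mul_assoc, sqrt_div_mul_sqrt_div hn0 (H.p₁_pos n)]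
  ring

theorem hasJet_jetC (H : AssumptionH β p₁ p₂ γ σ)
    (hJ : ∀ n : ℕ+, IsJacobiCoefficients (P n) n (β n) (p₁ n) (p₂ n) (c n) (s n)) (k : ℕ) :
    HasJet P atTop (fun n : ℕ+ => √(β n / 2 * n)) (fluct β p₁ p₂ c s)
      (fun n ω => c n k ω) (jetC γ σ k) := by
  cases k with
  | zero =>
    refine (hasJet_const (m := fun _ => 0) tendsto_const_nhds).congr (Eventually.of_forall fun n =>
      Eventually.of_forall fun ω => ?_)
    simp [(hJ n).c_zero]
  | succ k =>
    have hZ := momentBounded_fluct H hJ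
    refine ((hasJet_const (m := fun n : ℕ+ => p₁ n / (p₁ n + p₂ n)) H.tendsto_p₁_div_add).mul hZ
      H.tendsto_sqrt_beta_mul (hasJet_jetE H hJ k)).congr (Eventually.of_forall fun n =>
      Eventually.of_forall fun ω => ?_)
    have h1 := H.p₁_pos n
    have h2 := H.p₂_pos n
    simp only [Pi.mul_apply]
    field_simp

/-- The rescaled diagonal entry equals D_k + √(n/p₁) S_{k-1}(1 - c_{k-1} - c_k). Every coefficient
in this form converges, also when γ = 0 or σ = 0. -/
theorem hasJet_jetDiag (H : AssumptionH β p₁ p₂ γ σ)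
    (hJ : ∀ n : ℕ+, IsJacobiCoefficients (P n) n (β n) (p₁ n) (p₂ n) (c n) (s n)) (k : ℕ) :
    HasJet P atTop (fun n : ℕ+ => √(β n / 2 * n)) (fluct β p₁ p₂ c s)
      (fun n ω => (√(n * p₁ n))⁻¹ * ((p₁ n + p₂ n) *
        coeffA (fun j => c n j ω) (fun j => s n j ω) (k + 1) - p₁ n))
      (jetDiag γ σ (k + 1)) := by
  have hZ := momentBounded_fluct H hJ
  have ht := H.tendsto_sqrt_beta_mul
  refine ((hasJet_jetD H k).add (((hasJet_const (m := fun n : ℕ+ => √(n / p₁ n))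
    H.tendsto_gamma.sqrt).mul hZ ht (hasJet_jetS H hJ k)).mul hZ ht
    (((hasJet_const (m := fun _ => 1) tendsto_const_nhds).sub hZ ht (hasJet_jetC H hJ k)).sub hZ ht
      (hasJet_jetC H hJ (k + 1))))).congr
      (Eventually.of_forall fun n => Eventually.of_forall fun ω => ?_)
  have h1 := H.p₁_pos n
  have hn0 : 0 < (n : ℝ) := by exact_mod_cast n.pos
  have e1 : √(p₁ n / n) = (√(n * p₁ n))⁻¹ * p₁ n := by
    rw [Real.sqrt_div h1.le, Real.sqrt_mul hn0.le]
    have := Real.sqrt_pos.2 h1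
    have := Real.sqrt_pos.2 hn0
    field_simp
    exact Real.sq_sqrt h1.le
  have e2 : √(n / p₁ n) = (√(n * p₁ n))⁻¹ * n := by
    rw [Real.sqrt_div hn0.le, Real.sqrt_mul hn0.le]
    have := Real.sqrt_pos.2 h1
    have := Real.sqrt_pos.2 hn0
    field_simp
    exact Real.sq_sqrt hn0.le
  simp only [Pi.add_apply, Pi.mul_apply, Pi.sub_apply, coeffA, Nat.add_sub_cancel, e1, e2]
  field_simp
  ring

/-- Distribute (p₁+p₂)²/(np₁) as (p₁+p₂)/p₁ on c_k and (p₁+p₂)/n on s_k, and write s_{k-1} =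
n/(p₁+p₂) · S_{k-1}. -/
theorem hasJet_jetOffDiagSq (H : AssumptionH β p₁ p₂ γ σ)
    (hJ : ∀ n : ℕ+, IsJacobiCoefficients (P n) n (β n) (p₁ n) (p₂ n) (c n) (s n)) (k : ℕ) :
    HasJet P atTop (fun n : ℕ+ => √(β n / 2 * n)) (fluct β p₁ p₂ c s)
      (fun n ω => (n * p₁ n)⁻¹ * (p₁ n + p₂ n) ^ 2 * (c n (k + 1) ω * (1 - c n (k + 1) ω) *
        s n (k + 1) ω * (1 - s n k ω)))
      (jetOffDiagSq γ σ (k + 1)) := by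
  have hZ := momentBounded_fluct H hJ
  have ht := H.tendsto_sqrt_beta_mul
  have h1 : HasJet P atTop (fun n : ℕ+ => √(β n / 2 * n)) (fluct β p₁ p₂ c s)
      (fun _ _ => (1 : ℝ)) (.inl 1) := hasJet_const (m := fun _ => 1) tendsto_const_nhds
  refine ((((hasJet_jetE H hJ k).mul hZ ht (h1.sub hZ ht (hasJet_jetC H hJ (k + 1)))).mul hZ ht
    (hasJet_jetS H hJ (k + 1))).mul hZ ht (h1.sub hZ ht ((hasJet_const
      (m := fun n : ℕ+ => n / (p₁ n + p₂ n)) H.tendsto_div_add).mul hZ ht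
      (hasJet_jetS H hJ k)))).congr
      (Eventually.of_forall fun n => Eventually.of_forall fun ω => ?_)
  have h1 := H.p₁_pos n
  have h2 := H.p₂_pos n
  have hn0 : 0 < (n : ℝ) := by exact_mod_cast n.pos
  simp only [Pi.mul_apply, Pi.sub_apply]
  field_simp

theorem ae_mem_Ioo_of_isJacobiCoefficients {α : Type*} [MeasurableSpace α] {μ : Measure α} {n : ℕ}
    {β p₁ p₂ : ℝ} {c s : ℕ → α → ℝ} (h : IsJacobiCoefficients μ n β p₁ p₂ c s) :
    ∀ᵐ ω ∂μ, (∀ k ∈ Finset.Icc 1 n, c k ω ∈ Set.Ioo (0 : ℝ) 1) ∧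
      ∀ k ∈ Finset.Icc 1 (n - 1), s k ω ∈ Set.Ioo (0 : ℝ) 1 := by
  have hp : Measurable fun x : ℝ => x ∈ Set.Ioo (0 : ℝ) 1 :=
    measurable_mem.2 measurableSet_Ioo
  refine Eventually.and ?_ ?_
  · exact (Finset.eventually_all _).2 fun k hk =>
      ((h.law_c k hk).ae_iff hp).2 (ae_mem_Ioo_betaMeasure _ _)
  · exact (Finset.eventually_all _).2 fun k hk =>
      ((h.law_s k hk).ae_iff hp).2 (ae_mem_Ioo_betaMeasure _ _)

theorem hasJet_spectralPairing (H : AssumptionH β p₁ p₂ γ σ)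
    (hJ : ∀ n : ℕ+, IsJacobiCoefficients (P n) n (β n) (p₁ n) (p₂ n) (c n) (s n)) (p : ℝ[X]) :
    HasJet P atTop (fun n : ℕ+ => √(β n / 2 * n)) (fluct β p₁ p₂ c s)
      (fun n ω => spectralPairing n (p₁ n) (p₂ n) (c n) (s n) p ω) (jetPairing γ σ p) := by
  have hZ := momentBounded_fluct H hJ
  have ht := H.tendsto_sqrt_beta_mul
  set A : ℕ → ∀ n, Ω n → ℝ := fun j n ω => (√(n * p₁ n))⁻¹ * ((p₁ n + p₂ n) *
    coeffA (fun i => c n i ω) (fun i => s n i ω) j - p₁ n) with hA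
  set D : ℕ → ∀ n, Ω n → ℝ := fun j n ω => (n * p₁ n)⁻¹ * (p₁ n + p₂ n) ^ 2 *
    (c n j ω * (1 - c n j ω) * s n j ω * (1 - s n (j - 1) ω)) with hD
  have hpow : ∀ k, HasJet P atTop (fun n : ℕ+ => √(β n / 2 * n)) (fluct β p₁ p₂ c s)
      (tridiagonalPowCol A D k 0)
      (tridiagonalPowCol (jetDiag γ σ) (jetOffDiagSq γ σ) k 0) := fun k =>
    HasJet.tridiagonalPowCol hZ ht (a := A) (d := D)
      (fun j => hasJet_jetDiag H hJ j) (fun j => hasJet_jetOffDiagSq H hJ j) k 0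
  have hterm : ∀ k, HasJet P atTop (fun n : ℕ+ => √(β n / 2 * n)) (fluct β p₁ p₂ c s)
      ((fun _ _ => p.coeff k) * tridiagonalPowCol A D k 0)
      (.inl (p.coeff k) * tridiagonalPowCol (jetDiag γ σ) (jetOffDiagSq γ σ) k 0) := fun k =>
    (hasJet_const (m := fun _ => p.coeff k) tendsto_const_nhds).mul hZ ht (hpow k)
  have hsum := HasJet.sum (Finset.range (p.natDegree + 1)) (fun k _ => hterm k)
  rw [jetPairing]
  refine hsum.congr ?_
  filter_upwards [eventually_lt_pnat_cast p.natDegree] with n hn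
  have hn' : p.natDegree < (n : ℕ) := by exact_mod_cast hn
  -- The identification is only almost sure: squaring `coeffB` returns its radicand only where that
  -- is nonnegative.
  filter_upwards [ae_mem_Ioo_of_isJacobiCoefficients (hJ n)] with ω ⟨hc, hs⟩
  rw [spectralPairing_eq_sum_tridiagonalPowCol n (p₁ n) (p₂ n) (c n) (s n) p ω hn'.le
    (fun j => A j n ω) (fun j => D j n ω) (fun i => rfl)]
  · simp only [Finset.sum_apply, Pi.mul_apply]
    refine Finset.sum_congr rfl fun k _ => ?_
    congr 1
    -- Evaluation at the index n and the sample point ω is a ring homomorphism.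
    exact map_tridiagonalPowCol ((Pi.evalRingHom _ ω).comp (Pi.evalRingHom (fun n => Ω n → ℝ) n))
      A D k 0
  · intro i hi
    have hci := hc (i + 1) (Finset.mem_Icc.2 ⟨by omega, by omega⟩)
    have hsi := hs (i + 1) (Finset.mem_Icc.2 ⟨by omega, by omega⟩)
    have hsi' : s n i ω ≤ 1 := by
      rcases Nat.eq_zero_or_pos i with rfl | h
      · rw [(hJ n).s_zero]; exact zero_le_one
      · exact (hs i (Finset.mem_Icc.2 ⟨by omega, by omega⟩)).2.le
    have h1 := H.p₁_pos n
    have hn0 : 0 < (n : ℝ) := by exact_mod_cast n.pos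
    have hnn : 0 ≤ c n (i + 1) ω * (1 - c n (i + 1) ω) * s n (i + 1) ω * (1 - s n i ω) :=
      mul_nonneg (mul_nonneg (mul_nonneg hci.1.le (by linarith [hci.2])) hsi.1.le) (by linarith)
    simp only [hD, coeffB, Nat.add_sub_cancel]
    rw [mul_pow, mul_pow, inv_pow, Real.sq_sqrt (by positivity), Real.sq_sqrt hnn]
    ring

end JacobiJets

/-! ### Boundedness of the matrix entries and integrability of the pairing. -/

section Integrability

/-- L^∞ is closed under products, so powers of a matrix with bounded entries are bounded. This
covers every n, including n below the degree of p, where the recursion formula is not available. -/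
theorem memLp_top_matrix_pow {α : Type*} [MeasurableSpace α] {μ : Measure α} {n : ℕ}
    {M : α → Matrix (Fin n) (Fin n) ℝ} (h : ∀ i j, MemLp (fun ω => M ω i j) ⊤ μ) (k : ℕ)
    (i j : Fin n) : MemLp (fun ω => (M ω ^ k) i j) ⊤ μ := by
  induction k generalizing j with
  | zero =>
    simp only [pow_zero]
    exact memLp_top_const _
  | succ k ih =>
    simp only [pow_succ, Matrix.mul_apply]
    exact memLp_finsetSum _ fun m _ => (h m j).mul (ih m)

variable {α : Type*} [MeasurableSpace α] {μ : Measure α} {n : ℕ}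
  {β p₁ p₂ : ℝ} {c s : ℕ → α → ℝ}

theorem memLp_top_c (h : IsJacobiCoefficients μ n β p₁ p₂ c s) {k : ℕ} (hk : k ≤ n) :
    MemLp (c k) ⊤ μ := by
  rcases Nat.eq_zero_or_pos k with rfl | h0
  · have : c 0 = fun _ => 0 := funext h.c_zero
    rw [this]
    exact memLp_top_const _
  · have hk : k ∈ Finset.Icc 1 n := Finset.mem_Icc.2 ⟨h0, hk⟩
    refine memLp_top_of_bound (h.law_c k hk).aemeasurable.aestronglyMeasurable 1 ?_
    filter_upwards [ae_mem_Ioo_of_isJacobiCoefficients h] with ω hω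
    have := hω.1 k hk
    rw [Real.norm_eq_abs, abs_le]
    constructor <;> linarith [this.1, this.2]

theorem memLp_top_s (h : IsJacobiCoefficients μ n β p₁ p₂ c s) {k : ℕ} (hk : k ≤ n - 1) :
    MemLp (s k) ⊤ μ := by
  rcases Nat.eq_zero_or_pos k with rfl | h0
  · have : s 0 = fun _ => 0 := funext h.s_zero
    rw [this]
    exact memLp_top_const _
  · have hk : k ∈ Finset.Icc 1 (n - 1) := Finset.mem_Icc.2 ⟨h0, hk⟩
    refine memLp_top_of_bound (h.law_s k hk).aemeasurable.aestronglyMeasurable 1 ?_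
    filter_upwards [ae_mem_Ioo_of_isJacobiCoefficients h] with ω hω
    have := hω.2 k hk
    rw [Real.norm_eq_abs, abs_le]
    constructor <;> linarith [this.1, this.2]

theorem MemLp.sqrt_top {f : α → ℝ} (hf : MemLp f ⊤ μ) : MemLp (fun ω => √(f ω)) ⊤ μ := by
  have hb := ae_le_eLpNormEssSup (f := f) (μ := μ)
  have htop : eLpNormEssSup f μ < ⊤ := by simpa [eLpNorm_exponent_top] using hf.2
  refine memLp_top_of_bound (Real.continuous_sqrt.comp_aestronglyMeasurable hf.1)
    √(eLpNormEssSup f μ).toReal ?_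
  filter_upwards [hb] with ω hω
  rw [Real.norm_eq_abs, abs_of_nonneg (Real.sqrt_nonneg _)]
  refine Real.sqrt_le_sqrt ((le_abs_self _).trans ?_)
  rw [← Real.norm_eq_abs, ← toReal_enorm]
  exact ENNReal.toReal_mono htop.ne hω

theorem memLp_top_rescaledJacobiMatrix (h : IsJacobiCoefficients μ n β p₁ p₂ c s) (i j : Fin n) :
    MemLp (fun ω => rescaledJacobiMatrix n p₁ p₂ (fun k => c k ω) (fun k => s k ω) i j) ⊤ μ := by
  have hone : MemLp (fun _ : α => (1 : ℝ)) ⊤ μ := memLp_top_const _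
  have hA : ∀ k, k + 1 ≤ n → MemLp (fun ω => (√(n * p₁))⁻¹ * ((p₁ + p₂) *
      coeffA (fun k => c k ω) (fun k => s k ω) (k + 1) - p₁)) ⊤ μ := fun k hk => by
    have h1 := memLp_top_c h hk
    have h2 := memLp_top_c h (show k ≤ n by omega)
    have h3 := memLp_top_s h (show k ≤ n - 1 by omega)
    have h4 : MemLp (s k * (fun ω => 1 - c k ω) + c (k + 1) * (fun ω => 1 - s k ω)) ⊤ μ :=
      ((hone.sub h2).mul h3).add ((hone.sub h3).mul h1)
    exact ((h4.const_mul (p₁ + p₂)).sub (memLp_top_const p₁)).const_mul _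
  have hB : ∀ k, k + 1 < n → MemLp (fun ω => (√(n * p₁))⁻¹ * ((p₁ + p₂) *
      coeffB (fun k => c k ω) (fun k => s k ω) (k + 1))) ⊤ μ := fun k hk => by
    have h1 := memLp_top_c h hk.le
    have h3 := memLp_top_s h (show k ≤ n - 1 by omega)
    have h4 := memLp_top_s h (show k + 1 ≤ n - 1 by omega)
    have h6 : MemLp (c (k + 1) * fun ω => 1 - c (k + 1) ω) ⊤ μ := (hone.sub h1).mul h1
    have h7 : MemLp (c (k + 1) * (fun ω => 1 - c (k + 1) ω) * s (k + 1)) ⊤ μ := h4.mul h6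
    have h5 : MemLp (c (k + 1) * (fun ω => 1 - c (k + 1) ω) * s (k + 1) * (fun ω => 1 - s k ω))
        ⊤ μ := (hone.sub h3).mul h7
    exact ((MemLp.sqrt_top h5).const_mul (p₁ + p₂)).const_mul _
  simp only [rescaledJacobiMatrix_eq_tridiagonal, tridiagonal, Matrix.of_apply]
  split_ifs with h1 h2 h3
  · exact hA i (by omega)
  · exact hB i (by omega)
  · exact hB j (by omega)
  · exact memLp_top_const 0

theorem integrable_spectralPairing [IsProbabilityMeasure μ] [NeZero n]
    (h : IsJacobiCoefficients μ n β p₁ p₂ c s)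
    (p : ℝ[X]) : Integrable (spectralPairing n p₁ p₂ c s p) μ := by
  have e : spectralPairing n p₁ p₂ c s p = fun ω => ∑ k ∈ Finset.range (p.natDegree + 1),
      p.coeff k * (rescaledJacobiMatrix n p₁ p₂ (fun k => c k ω) (fun k => s k ω) ^ k) 0 0 :=
    funext fun ω => spectralPairing_eq_sum n p₁ p₂ c s p ω
  rw [e]
  exact integrable_finsetSum _ fun k _ =>
    ((memLp_top_matrix_pow (memLp_top_rescaledJacobiMatrix h) k 0 0).integrable le_top).const_mul _

end Integrability

/-! ### Gaussian limit of the linear part and conclusion. -/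

section CentralLimit

variable {Ω : ℕ+ → Type*} [∀ n, MeasurableSpace (Ω n)] {P : ∀ n, Measure (Ω n)}
  {β p₁ p₂ : ℕ+ → ℝ} {γ σ : ℝ} {c s : ∀ n, ℕ → Ω n → ℝ}

/-- The strict bound places k + 1 in the index range of the c's and also in the shorter range of the
s's. -/
theorem iIndepFun_jacobiCoord {n : ℕ+}
    (hJ : IsJacobiCoefficients (P n) n (β n) (p₁ n) (p₂ n) (c n) (s n))
    {S : Finset (ℕ ⊕ ℕ)} (hS : ∀ a ∈ S, Sum.elim id id a + 1 < (n : ℕ)) :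
    iIndepFun (fun a : S => jacobiCoord c s (a : ℕ ⊕ ℕ) n) (P n) := by
  let g : S → Finset.Icc 1 (n : ℕ) ⊕ Finset.Icc 1 ((n : ℕ) - 1) := fun a =>
    match a with
    | ⟨.inl k, h⟩ => .inl ⟨k + 1, Finset.mem_Icc.2 ⟨by omega, by have := hS _ h; simp at this; omega⟩⟩
    | ⟨.inr k, h⟩ => .inr ⟨k + 1, Finset.mem_Icc.2 ⟨by omega, by have := hS _ h; simp at this; omega⟩⟩
  have hg : Function.Injective g := by
    rintro ⟨a | a, ha⟩ ⟨b | b, hb⟩ hab <;> simp [g] at hab ⊢ <;> exact hab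
  have h := hJ.indep.precomp hg
  convert h using 1
  funext a
  obtain ⟨a | a, ha⟩ := a <;> rfl

/-- By independence the characteristic function factors over the support of q, and each factor,
taken at q_a u, has a centred Gaussian limit; the exponents add up. -/
theorem tendsto_charFun_linearCombination (H : AssumptionH β p₁ p₂ γ σ)
    (hJ : ∀ n : ℕ+, IsJacobiCoefficients (P n) n (β n) (p₁ n) (p₂ n) (c n) (s n))
    (q : ℕ ⊕ ℕ →₀ ℝ) (u : ℝ) :
    Tendsto (fun n => charFun ((P n).map fun ω =>
        Finsupp.linearCombination ℝ (fun a => fluct β p₁ p₂ c s a n ω) q) u) atTop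
      (𝓝 (Complex.exp (-((∑ a ∈ q.support, limitVar γ σ a * q a ^ 2 : ℝ) * (u : ℂ) ^ 2 / 2)))) := by
  have h1 : Tendsto (fun n => ∏ a ∈ q.support,
      charFun ((P n).map (fluct β p₁ p₂ c s a n)) (q a * u)) atTop
      (𝓝 (∏ a ∈ q.support, Complex.exp (-(limitVar γ σ a * ((q a * u : ℝ) : ℂ) ^ 2 / 2)))) :=
    tendsto_finsetProd _ fun a _ => tendsto_charFun_beta (eventually_hasLaw_jacobiCoord hJ a)
      (H.tendsto_shapeA a) (H.shapeB_pos a) (H.tendsto_fluctScale a) (H.tendsto_shapeB_div a) _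
  have h2 : ∏ a ∈ q.support, Complex.exp (-(limitVar γ σ a * ((q a * u : ℝ) : ℂ) ^ 2 / 2)) =
      Complex.exp (-((∑ a ∈ q.support, limitVar γ σ a * q a ^ 2 : ℝ) * (u : ℂ) ^ 2 / 2)) := by
    rw [← Complex.exp_sum]
    congr 1
    push_cast
    rw [Finset.sum_mul, Finset.sum_div, ← Finset.sum_neg_distrib]
    exact Finset.sum_congr rfl fun a _ => by ring
  rw [h2] at h1
  refine h1.congr' ?_
  have hlarge : ∀ᶠ n : ℕ+ in atTop, ∀ a ∈ q.support, Sum.elim id id a + 1 < (n : ℕ) :=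
    (Finset.eventually_all _).2 fun a _ => tendsto_PNat_val_atTop_atTop.eventually_gt_atTop _
  have hlaw := (Finset.eventually_all q.support).2
    fun a _ => eventually_hasLaw_jacobiCoord hJ a
  filter_upwards [hlarge, hlaw] with n hn hlaw
  have hind := (iIndepFun_jacobiCoord (hJ n) hn).comp (fun a x => q a * (fluctScale β p₁ p₂ a n *
    (x - shapeA β p₁ a n / (shapeA β p₁ a n + shapeB β p₁ p₂ a n)))) (fun a => by fun_prop)
  have hm : ∀ a : q.support, AEMeasurable ((fun x => q a * (fluctScale β p₁ p₂ a n *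
    (x - shapeA β p₁ a n / (shapeA β p₁ a n + shapeB β p₁ p₂ a n)))) ∘
      jacobiCoord c s (a : ℕ ⊕ ℕ) n) (P n) := fun a =>
    Measurable.comp_aemeasurable (by fun_prop) (hlaw a a.2).aemeasurable
  have hprod := hind.charFun_map_fun_sum_eq_prod hm
  have e : (fun ω => Finsupp.linearCombination ℝ (fun a => fluct β p₁ p₂ c s a n ω) q) =
      fun ω => ∑ a : q.support, ((fun x => q a * (fluctScale β p₁ p₂ a n *
        (x - shapeA β p₁ a n / (shapeA β p₁ a n + shapeB β p₁ p₂ a n)))) ∘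
        jacobiCoord c s (a : ℕ ⊕ ℕ) n) ω := by
    funext ω
    rw [Finsupp.linearCombination_apply, Finsupp.sum, ← Finset.sum_coe_sort]
    rfl
  rw [e, hprod, Finset.prod_apply, ← Finset.prod_coe_sort]
  refine Finset.prod_congr rfl fun a _ => ?_
  rw [← charFun_map_mul_comp]
  · rfl
  · exact (((hlaw a a.2).aemeasurable.sub_const _).const_mul _)

theorem AssumptionH.pairingVar_nonneg (H : AssumptionH β p₁ p₂ γ σ) (p : ℝ[X]) :
    0 ≤ pairingVar γ σ p :=
  Finset.sum_nonneg fun a _ => mul_nonneg (H.limitVar_nonneg a) (sq_nonneg _)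

/-- Passes to sequences indexed by ℕ, the form in which the continuity theorem is applied. -/
theorem tendsto_of_comp_succPNat {α : Type*} {f : ℕ+ → α} {l : Filter α}
    (h : Tendsto (fun n : ℕ => f n.succPNat) atTop l) : Tendsto f atTop l := by
  have h1 : Tendsto (fun n : ℕ+ => n.natPred) atTop atTop :=
    (tendsto_sub_atTop_nat 1).comp tendsto_PNat_val_atTop_atTop
  refine (h.comp h1).congr fun n => ?_
  simp [Function.comp]

theorem tendstoInDistribution_gaussianReal_of_tendsto_charFun
    [∀ n, IsProbabilityMeasure (P n)] {v : ℝ≥0} {Y : ∀ n, Ω n → ℝ}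
    (hY : ∀ n, AEMeasurable (Y n) (P n))
    (h : ∀ u : ℝ, Tendsto (fun n => charFun ((P n).map (Y n)) u) atTop
      (𝓝 (Complex.exp (-(v * (u : ℂ) ^ 2 / 2))))) :
    TendstoInDistribution Y atTop (id : ℝ → ℝ) P (gaussianReal 0 v) where
  forall_aemeasurable := hY
  tendsto := by
    refine tendsto_of_comp_succPNat (ProbabilityMeasure.tendsto_iff_tendsto_charFun.2 fun u => ?_)
    have h1 : charFun ((gaussianReal 0 v).map id) u = Complex.exp (-(v * (u : ℂ) ^ 2 / 2)) := by
      rw [Measure.map_id, charFun_gaussianReal]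
      simp
    simp only [ProbabilityMeasure.coe_mk, h1]
    exact (h u).comp OrderIso.pnatIsoNat.symm.tendsto_atTop

end CentralLimit

theorem theorem3 (γ σ : ℝ) (p : ℝ[X]) :
    ∃ v : ℝ≥0, ∀ (Ω : ℕ+ → Type*) [∀ n, MeasurableSpace (Ω n)]
      (P : ∀ n, Measure (Ω n)) [∀ n, IsProbabilityMeasure (P n)]
      (β p₁ p₂ : ℕ+ → ℝ) (c s : ∀ n, ℕ → Ω n → ℝ),
      AssumptionH β p₁ p₂ γ σ →
      (∀ n : ℕ+, IsJacobiCoefficients (P n) n (β n) (p₁ n) (p₂ n) (c n) (s n)) →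
      (∀ n : ℕ+, Integrable (spectralPairing n (p₁ n) (p₂ n) (c n) (s n) p) (P n)) ∧
      TendstoInDistribution
        (fun n ω => √(β n / 2 * (n : ℝ)) *
          (spectralPairing n (p₁ n) (p₂ n) (c n) (s n) p ω -
            ∫ ω', spectralPairing n (p₁ n) (p₂ n) (c n) (s n) p ω' ∂(P n)))
        atTop (id : ℝ → ℝ) P (gaussianReal 0 v) := by
  -- The variance is chosen before the parameters, from γ, σ and p alone. Truncation to ℝ≥0 is
  -- harmless, since `AssumptionH` forces `pairingVar` to be nonnegative.
  refine ⟨(pairingVar γ σ p).toNNReal, fun Ω _ P _ β p₁ p₂ c s H hJ => ?_⟩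
  have hint := fun n => integrable_spectralPairing (hJ n) p
  refine ⟨hint, tendstoInDistribution_gaussianReal_of_tendsto_charFun (fun n =>
    (((hint n).sub (integrable_const _)).const_mul _).aemeasurable) fun u => ?_⟩
  rw [Real.coe_toNNReal _ (H.pairingVar_nonneg p)]
  have hcenter : ∀ a, ∀ᶠ n in atTop, ∫ ω, fluct β p₁ p₂ c s a n ω ∂P n = 0 := fun a => by
    filter_upwards [eventually_hasLaw_jacobiCoord hJ a, (H.tendsto_shapeA a).eventually_gt_atTop 0,
      H.shapeB_pos a] with n h1 h2 h3
    exact integral_beta_centered_eq_zero h2 h3 h1 _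
  -- The difference to the characteristic function of the linear part tends to 0, and that of the
  -- linear part tends to the Gaussian one.
  have h := ((hasJet_spectralPairing H hJ p).tendsto_charFun_sub (momentBounded_fluct H hJ)
    hcenter hint u).add (tendsto_charFun_linearCombination H hJ (jetPairing γ σ p).snd u)
  simpa [pairingVar] using h
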